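/- Let $\lambda=(\lambda_1\ge\lambda_2\ge\cdots)$ be a partition with at most $m$ nonzero parts, where $m\ge 1$. Regard $\lambda$ as the sequence $(\lambda_1,\dots,\lambda_m)$, padded with zeros, and write it in exponential notation $\lambda=\ell_1^{e_1}\cdots\ell_k^{e_k}$ with $k \ge 1$, $\ell_1>\cdots>\ell_k\ge 0$ and all $e_a>0$, meaning that exactly $e_a$ of the entries $\lambda_1,\dots,\lambda_m$ equal $\ell_a$ (so $m=e_1+\cdots+e_k$). Let $\mathrm{SSYT}_{\le m}(\lambda)$ be the finite set of semistandard Young tableaux of shape $\lambda$ with labels in $\{1,\dots,m\}$, and let $\mathcal X_{\lambda;m}[\mathrm{rank}]$ be the value of the statistic $\mathrm{rank}(T)=\sum_{i\ge 1}(i-1)\,\alpha_i(T)$ at a uniformly random $T\in\mathrm{SSYT}_{\le m}(\lambda)$, where $\alpha_i(T)$ is the number of labels of $T$ equal to $i$. Let $\kappa_d^{\lambda;m}$ be its $d$-th cumulant, i.e. the coefficient of $t^d/d!$ in $\log\mathbb E\big[e^{t\mathcal X_{\lambda;m}[\mathrm{rank}]}\big]$. (1) For every even $d\ge 2$, $$(-1)^{d/2+1}\,\kappa_d^{\lambda;m}=\Theta\Big(\sum_{1\le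 a<b\le k}(\ell_a-\ell_b)\,e_ae_b\,(\ell_a-\ell_b-1+e_a+e_{a+1}+\cdots+e_b)^{d-1}\Big),$$ that is, there are constants $A,B>0$ depending only on $d$ such that, for all such $\lambda$ and $m$, the left-hand side is at least $A$ times and at most $B$ times the sum on the right. In particular $|\kappa_d^{\lambda;m}|$ is $\Theta$ of that sum. (2) Put $$\mathrm{weft}(\lambda)=\frac{\sum_{1\le a<b\le k}(\ell_a-\ell_b)\,e_ae_b\,(\ell_a-\ell_b-1+e_a+\cdots+e_b)}{(\ell_1-\ell_k-1+m)^2}$$ (read as $0$ in the degenerate case $k=m=1$, where the denominator vanishes). If $\lambda^{(N)}$, $m^{(N)}$ $(N=1,2,\dots)$ is a sequence of such partitions and integers with $\mathrm{weft}(\lambda^{(N)})\to\infty$ as $N\to\infty$, then $\mathcal X_{\lambda^{(N)};m^{(N)}}[\mathrm{rank}]$ is asymptotically normal: the standardized variables $(\mathcal X-\mathbb E\mathcal X)/\sigma$, which are defined for all large $N$, converge in distribution to the standard normal law. -/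

import Mathlib

open MeasureTheory ProbabilityTheory Filter

noncomputable section

/-- The number `α_i` of cells of the tableau `T` that carry the label `i`. -/
def ssytType {μ : YoungDiagram} (T : SemistandardYoungTableau μ) (i : ℕ) : ℕ :=
  (μ.cells.filter fun c => T c.1 c.2 = i).card

/-- The rank `∑_{i ≥ 1} (i - 1) α_i` of a tableau, where `α_i` is the number of labels equal to `i`.
Only finitely many terms are nonzero; the term `i = 0` vanishes by truncated subtraction. -/
def ssytRank {μ : YoungDiagram} (T : SemistandardYoungTableau μ) : ℕ :=
  ∑ᶠ i : ℕ, (i - 1) * ssytType T i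

/-- The set of semistandard Young tableaux of shape `μ` with labels in `{1, …, m}`.
(Mathlib's tableaux are filled with natural numbers, and the label `0` is excluded here.) -/
def ssytLE (μ : YoungDiagram) (m : ℕ) : Set (SemistandardYoungTableau μ) :=
  {T | ∀ c ∈ μ.cells, 1 ≤ T c.1 c.2 ∧ T c.1 c.2 ≤ m}

instance ssytMeasurableSpace (μ : YoungDiagram) :
    MeasurableSpace (SemistandardYoungTableau μ) := ⊤

/-- The uniform distribution on the semistandard tableaux of shape `μ` with labels at most `m`. -/
def ssytUniform (μ : YoungDiagram) (m : ℕ) : Measure (SemistandardYoungTableau μ) :=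
  uniformOn (ssytLE μ m)

/-- The rank as a real random variable. -/
def ssytRankRV (μ : YoungDiagram) (T : SemistandardYoungTableau μ) : ℝ := (ssytRank T : ℝ)

/-- The `d`-th cumulant of `X`: the coefficient of `t ^ d / d!` in `log 𝔼[exp (t X)]`. -/
def cumulant {Ω : Type*} [MeasurableSpace Ω] (X : Ω → ℝ) (P : Measure Ω) (d : ℕ) : ℝ :=
  iteratedDeriv d (cgf X P) 0

/-- The `d`-th cumulant of the rank of a uniformly random semistandard tableau of shape `μ` with
labels at most `m`. -/
def rankCumulant (μ : YoungDiagram) (m d : ℕ) : ℝ :=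
  cumulant (ssytRankRV μ) (ssytUniform μ m) d

/-- The standardized random variable `(X - 𝔼 X) / σ`. -/
def standardize {Ω : Type*} [MeasurableSpace Ω] (X : Ω → ℝ) (P : Measure Ω) (ω : Ω) : ℝ :=
  (X ω - ∫ ω', X ω' ∂P) / Real.sqrt (variance X P)

/-- A sequence of random variables `X N` on probability spaces `(Ω N, P N)` is asymptotically
normal if the standardized variables converge in distribution to the standard normal law. -/
def AsymptoticallyNormal {Ω : ℕ → Type*} [∀ N, MeasurableSpace (Ω N)]
    (X : ∀ N, Ω N → ℝ) (P : ∀ N, Measure (Ω N)) : Prop :=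
  ∃ _ : ∀ N, IsProbabilityMeasure (P N),
    TendstoInDistribution (fun N => standardize (X N) (P N)) atTop (id : ℝ → ℝ) P (gaussianReal 0 1)

/-- `μ`, regarded as a partition `(μ_1 ≥ ⋯ ≥ μ_m ≥ 0)` with exactly `m` rows (some of which may be
empty), is written `ℓ_1 ^ e_1 ⋯ ℓ_k ^ e_k` in exponential notation: it has at most `m` nonempty
rows, `ℓ_1 > ⋯ > ℓ_k ≥ 0`, all `e_a > 0`, and exactly `e_a` of its `m` rows have length `ℓ_a`.
The values of `ℓ` and `e` outside `{1, …, k}` play no role. -/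
structure IsExponentialNotation (μ : YoungDiagram) (m k : ℕ) (ℓ e : ℕ → ℕ) : Prop where
  length_le : μ.colLen 0 ≤ m
  one_le : 1 ≤ k
  strictAnti : StrictAntiOn ℓ (Set.Icc 1 k)
  pos : ∀ a ∈ Finset.Icc 1 k, 0 < e a
  rows : (Multiset.range m).map μ.rowLen =
    ∑ a ∈ Finset.Icc 1 k, Multiset.replicate (e a) (ℓ a)

/-- `∑_{1 ≤ a < b ≤ k} (ℓ_a - ℓ_b) e_a e_b (ℓ_a - ℓ_b - 1 + e_a + e_{a+1} + ⋯ + e_b) ^ p`. -/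
def pairSum (k : ℕ) (ℓ e : ℕ → ℕ) (p : ℕ) : ℝ :=
  ∑ a ∈ Finset.Icc 1 k, ∑ b ∈ Finset.Ioc a k,
    ((ℓ a : ℝ) - ℓ b) * e a * e b *
      ((ℓ a : ℝ) - ℓ b - 1 + ∑ c ∈ Finset.Icc a b, (e c : ℝ)) ^ p

/-- The statistic `weft`. -/
def weft (m k : ℕ) (ℓ e : ℕ → ℕ) : ℝ :=
  pairSum k ℓ e 1 / ((ℓ 1 : ℝ) - ℓ k - 1 + m) ^ 2

end

/-! ### Branching rule for semistandard tableaux -/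

namespace SemistandardYoungTableau

variable {lam mu : YoungDiagram}

/-! The generating function of the rank is a principal specialization of a Schur function, hence a
ratio of Vandermonde determinants in powers of one variable. With that variable equal to `exp (-z)`,
each difference `e^(-zb) - e^(-za)` is `z (a - b)` times an exponential times `sinhc (z (a - b) /
2)`, where `sinhc x = sinh x / x`. Normalizing at `z = 0` gives `E[e^(zX)] = e^(cz) ∏_{i<j} sinhc (z
g_ij / 2) / sinhc (z (j - i) / 2)`, with `g_ij = λ_i - λ_j + j - i`.

Cumulants are read off from the logarithm: for `d ≥ 2` the `d`-th one is a universal constant times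
`S_d = ∑_{i<j} (g_ij^d - (j - i)^d)` (`rankCumulant_eq`). The constant is the `d`-th derivative of
`log sinhc` at `0` over `2^d`; its sign for even `d` follows from the Riccati equation of `coth x -
1/x`.

To estimate `S_d`, note that `x^d - y^d` lies between `(x - y) x^(d-1)` and `d` times that. Between
two blocks of equal rows, `x - y = ℓ_a - ℓ_b` is constant, and `g^(d-1)` averages to a constant
fraction of its maximum, because reflecting the rectangle of row pairs matches small gaps with large
ones (`gapPowSum_bounds`).

For normality, on the imaginary axis `sinhc` becomes `sinc`, and `log (sinc x) = -x^2/6 + O(x^4)`.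
Since the variance is `S_2 / 12`, the quadratic terms add up to exactly `-t^2/2`. The error is at
most `t^4 D^2 / S_2`, with `D` the largest possible gap, and `D^2 / S_2 ≤ 4 / weft`. Lévy's
continuity theorem concludes. -/

lemma le_of_mem_ssytLE {T : SemistandardYoungTableau lam} {m : ℕ} (hT : T ∈ ssytLE lam m)
    (i j : ℕ) : T i j ≤ m := by
  by_cases h : (i, j) ∈ lam
  · exact (hT (i, j) (by simpa using h)).2
  · simp [T.zeros h]

lemma finite_ssytLE (lam : YoungDiagram) (m : ℕ) : (ssytLE lam m).Finite := by
  have : Function.Injective (fun (T : ssytLE lam m) (c : lam.cells) =>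
      (⟨T.1 c.1.1 c.1.2, Nat.lt_succ_of_le (le_of_mem_ssytLE T.2 _ _)⟩ : Fin (m + 1))) := by
    intro T S h
    apply Subtype.ext
    ext i j
    by_cases hc : (i, j) ∈ lam
    · simpa using congrFun h ⟨(i, j), by simpa using hc⟩
    · rw [T.1.zeros hc, S.1.zeros hc]
  exact Set.finite_coe_iff.mp (Finite.of_injective _ this)

/-- Columns increase strictly from a label at least `1`. This confines the cells with label at most
`n` to the first `n` rows. -/
lemma succ_le_of_mem_ssytLE {T : SemistandardYoungTableau lam} {m : ℕ} (hT : T ∈ ssytLE lam m)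
    {i j : ℕ} (h : (i, j) ∈ lam) : i + 1 ≤ T i j := by
  induction i with
  | zero => exact (hT (0, j) (by simpa using h)).1
  | succ i ih =>
    have h' : (i, j) ∈ lam := lam.up_left_mem (Nat.le_succ i) le_rfl h
    have : T i j < T (i + 1) j := T.col_strict (Nat.lt_succ_self i) h
    have := ih h'
    omega

/-- The shape formed by the cells whose labels are at most `n`. -/
def subShape (T : SemistandardYoungTableau lam) (n : ℕ) : YoungDiagram where
  cells := lam.cells.filter fun c => T c.1 c.2 ≤ n
  isLowerSet := by
    rintro ⟨i, j⟩ ⟨i', j'⟩ hle h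
    simp only [Finset.coe_filter, YoungDiagram.mem_cells, Set.mem_ofPred_eq] at h ⊢
    obtain ⟨hi, hj⟩ := Prod.mk_le_mk.mp hle
    refine ⟨lam.up_left_mem hi hj h.1, ?_⟩
    have h1 := T.col_weak hi h.1
    have h2 := T.row_weak_of_le hj (lam.up_left_mem hi le_rfl h.1)
    omega

lemma mem_subShape {T : SemistandardYoungTableau lam} {n i j : ℕ} :
    (i, j) ∈ subShape T n ↔ (i, j) ∈ lam ∧ T i j ≤ n := by
  rw [← YoungDiagram.mem_cells]
  simp [subShape]

/-- The restriction of a tableau to a smaller shape. -/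
def restrict (T : SemistandardYoungTableau lam) (h : mu ≤ lam) : SemistandardYoungTableau mu where
  entry i j := if (i, j) ∈ mu then T i j else 0
  row_weak' hj hc := by
    rw [if_pos hc, if_pos (mu.up_left_mem le_rfl hj.le hc)]
    exact T.row_weak hj (h hc)
  col_strict' hi hc := by
    rw [if_pos hc, if_pos (mu.up_left_mem hi.le le_rfl hc)]
    exact T.col_strict hi (h hc)
  zeros' h := if_neg h

lemma restrict_apply (T : SemistandardYoungTableau lam) (h : mu ≤ lam) (i j : ℕ) :
    T.restrict h i j = if (i, j) ∈ mu then T i j else 0 := rfl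

end SemistandardYoungTableau

/-! ### Interlacing shapes -/

/-- `mu` has at most `n` rows and interlaces `lam`: `lam_{i+1} ≤ mu_i ≤ lam_i` for `i < n`. -/
structure YoungDiagram.Interlaces (mu lam : YoungDiagram) (n : ℕ) : Prop where
  le_row : ∀ i < n, lam.rowLen (i + 1) ≤ mu.rowLen i
  row_le : ∀ i < n, mu.rowLen i ≤ lam.rowLen i
  row_zero : mu.rowLen n = 0

namespace YoungDiagram

variable {lam mu : YoungDiagram} {n : ℕ}

lemma rowLen_eq_zero_of_le {i j : ℕ} (h : lam.rowLen i = 0) (hij : i ≤ j) : lam.rowLen j = 0 :=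
  Nat.le_zero.mp (h ▸ lam.rowLen_anti i j hij)

lemma rowLen_eq_zero_iff {i : ℕ} : lam.rowLen i = 0 ↔ lam.colLen 0 ≤ i := by
  rw [← not_iff_not, ← ne_eq, ← Nat.pos_iff_ne_zero, ← mem_iff_lt_rowLen, mem_iff_lt_colLen, not_le]

lemma Interlaces.le (h : mu.Interlaces lam n) : mu ≤ lam := by
  rintro ⟨i, j⟩ hc
  have hc : (i, j) ∈ mu := hc
  rw [mem_iff_lt_rowLen] at hc ⊢
  rcases lt_or_ge i n with hi | hi
  · exact hc.trans_le (h.row_le i hi)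
  · rw [rowLen_eq_zero_of_le h.row_zero hi] at hc
    omega

lemma finite_interlaces (lam : YoungDiagram) (n : ℕ) : {mu | Interlaces mu lam n}.Finite := by
  refine Set.Finite.of_finite_image (f := YoungDiagram.cells) ?_ ?_
  · refine (Set.Finite.ofFinset lam.cells.powerset (fun x => Iff.rfl)).subset ?_
    rintro _ ⟨mu, hmu, rfl⟩
    simpa using cells_subset_iff.mpr (Interlaces.le hmu)
  · intro a _ b _ h
    exact YoungDiagram.ext h

end YoungDiagram

namespace SemistandardYoungTableau

variable {lam mu : YoungDiagram} {n : ℕ}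

/-- Strict columns hold at most one label `n + 1` each, so these labels form a horizontal strip. -/
lemma interlaces_subShape {T : SemistandardYoungTableau lam} (hT : T ∈ ssytLE lam (n + 1)) :
    (subShape T n).Interlaces lam n where
  le_row i _ := by
    by_contra! h
    have h1 := YoungDiagram.mem_iff_lt_rowLen.mpr h
    have h2 : ¬ (i, (subShape T n).rowLen i) ∈ subShape T n := by
      rw [YoungDiagram.mem_iff_lt_rowLen]; simp
    have h3 := T.col_strict (Nat.lt_succ_self i) h1
    have h4 := le_of_mem_ssytLE hT (i + 1) ((subShape T n).rowLen i)
    exact h2 (mem_subShape.mpr ⟨lam.up_left_mem (Nat.le_succ i) le_rfl h1, by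
      change T i _ < T (i + 1) _ at h3; omega⟩)
  row_le i _ := by
    by_contra! h
    have h1 := YoungDiagram.mem_iff_lt_rowLen.mpr h
    have h2 := (mem_subShape.mp h1).1
    rw [YoungDiagram.mem_iff_lt_rowLen] at h2
    omega
  row_zero := by
    by_contra h
    have h1 := mem_subShape.mp (YoungDiagram.mem_iff_lt_rowLen.mpr (Nat.pos_of_ne_zero h))
    have := succ_le_of_mem_ssytLE hT h1.1
    omega

/-- The extension of a tableau by labels `n + 1`. -/
def extend (h : mu.Interlaces lam n) (hlam : lam.colLen 0 ≤ n + 1)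
    (S : SemistandardYoungTableau mu) (hS : S ∈ ssytLE mu n) : SemistandardYoungTableau lam where
  entry i j := if (i, j) ∈ mu then S i j else if (i, j) ∈ lam then n + 1 else 0
  row_weak' {i j1 j2} hj hc := by
    by_cases h2 : (i, j2) ∈ mu
    · rw [if_pos h2, if_pos (mu.up_left_mem le_rfl hj.le h2)]
      exact S.row_weak hj h2
    · rw [if_neg h2, if_pos hc]
      have := le_of_mem_ssytLE hS i j1
      split_ifs <;> omega
  col_strict' {i1 i2 j} hi hc := by
    by_cases h2 : (i2, j) ∈ mu
    · rw [if_pos h2, if_pos (mu.up_left_mem hi.le le_rfl h2)]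
      exact S.col_strict hi h2
    · have hi2 : i2 < lam.colLen 0 :=
        YoungDiagram.mem_iff_lt_colLen.mp (lam.up_left_mem le_rfl (Nat.zero_le j) hc)
      -- By interlacing, row `i1 + 1` of `lam` is no longer than row `i1` of `mu`; so the upper cell
      -- is old and its label is at most `n`.
      have h1 : (i1, j) ∈ mu := by
        have h3 : (i1 + 1, j) ∈ lam := lam.up_left_mem hi le_rfl hc
        rw [YoungDiagram.mem_iff_lt_rowLen] at h3 ⊢
        exact h3.trans_le (h.le_row i1 (by omega))
      rw [if_neg h2, if_pos hc, if_pos h1]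
      have := le_of_mem_ssytLE hS i1 j
      omega
  zeros' {i j} hc := by
    rw [if_neg hc, if_neg fun h' => hc (h.le h')]

lemma extend_apply (h : mu.Interlaces lam n) (hlam : lam.colLen 0 ≤ n + 1)
    (S : SemistandardYoungTableau mu) (hS : S ∈ ssytLE mu n) (i j : ℕ) :
    extend h hlam S hS i j = if (i, j) ∈ mu then S i j else if (i, j) ∈ lam then n + 1 else 0 :=
  rfl

/-- The generating function of the tableaux of shape `lam` with labels in `{1, …, n}`, where a label
`i` has weight `p ^ (n - i)`. -/
noncomputable def corankGF {R : Type*} [CommRing R] (lam : YoungDiagram) (n : ℕ) (p : R) : R :=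
  ∑ T ∈ (finite_ssytLE lam n).toFinset, p ^ ∑ c ∈ lam.cells, (n - T c.1 c.2)

/-- Raising the maximal label by one costs each old cell one more unit, while the new cells,
labelled `n + 1`, cost nothing. -/
lemma sum_extend (h : mu.Interlaces lam n) (hlam : lam.colLen 0 ≤ n + 1)
    (S : SemistandardYoungTableau mu) (hS : S ∈ ssytLE mu n) :
    ∑ c ∈ lam.cells, (n + 1 - extend h hlam S hS c.1 c.2) =
      mu.card + ∑ c ∈ mu.cells, (n - S c.1 c.2) := by
  rw [← Finset.sum_subset (YoungDiagram.cells_subset_iff.mpr h.le), YoungDiagram.card,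
    Finset.card_eq_sum_ones, ← Finset.sum_add_distrib]
  · refine Finset.sum_congr rfl fun c hc => ?_
    rw [extend_apply, if_pos (by simpa using hc)]
    have := le_of_mem_ssytLE hS c.1 c.2
    omega
  · intro c hc hc'
    rw [extend_apply, if_neg (by simpa using hc'), if_pos (by simpa using hc)]
    omega

lemma extend_mem (h : mu.Interlaces lam n) (hlam : lam.colLen 0 ≤ n + 1)
    (S : SemistandardYoungTableau mu) (hS : S ∈ ssytLE mu n) :
    extend h hlam S hS ∈ ssytLE lam (n + 1) := by
  rintro ⟨i, j⟩ hc
  simp only [extend_apply]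
  have hc : (i, j) ∈ lam := by simpa using hc
  split_ifs with h1
  · have := hS (i, j) (by simpa using h1)
    simp only at this
    omega
  · omega

lemma subShape_extend (h : mu.Interlaces lam n) (hlam : lam.colLen 0 ≤ n + 1)
    (S : SemistandardYoungTableau mu) (hS : S ∈ ssytLE mu n) :
    subShape (extend h hlam S hS) n = mu := by
  apply YoungDiagram.ext
  ext ⟨i, j⟩
  rw [YoungDiagram.mem_cells, YoungDiagram.mem_cells, mem_subShape, extend_apply]
  have := le_of_mem_ssytLE hS i j
  constructor
  · rintro ⟨h1, h2⟩
    by_contra h3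
    rw [if_neg h3, if_pos h1] at h2
    omega
  · intro h1
    exact ⟨h.le h1, by rwa [if_pos h1]⟩

/-- Branching: a tableau is the same as its subtableau of labels at most `n` together with the outer
shape, the remaining cells being forced. -/
lemma corankGF_succ {R : Type*} [CommRing R] (hlam : lam.colLen 0 ≤ n + 1) (p : R) :
    corankGF lam (n + 1) p =
      ∑ mu ∈ (YoungDiagram.finite_interlaces lam n).toFinset, p ^ mu.card * corankGF mu n p := by
  classical
  rw [corankGF, ← Finset.sum_fiberwise_of_maps_to (g := fun T => subShape T n)
    (t := (YoungDiagram.finite_interlaces lam n).toFinset)]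
  swap
  · intro T hT
    simpa using interlaces_subShape (by simpa using hT)
  refine Finset.sum_congr rfl fun mu hmu => ?_
  have hmu : mu.Interlaces lam n := by simpa using hmu
  rw [corankGF, Finset.mul_sum]
  symm
  refine Finset.sum_bij (fun S hS => extend hmu hlam S (by simpa using hS)) ?_ ?_ ?_ ?_
  · intro S hS
    have hS : S ∈ ssytLE mu n := by simpa using hS
    simp [extend_mem, subShape_extend]
  · intro S hS S' hS' heq
    ext i j
    by_cases hc : (i, j) ∈ mu
    · have := congrArg (fun T : SemistandardYoungTableau lam => T i j) heq
      simpa [extend_apply, hc] using this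
    · rw [S.zeros hc, S'.zeros hc]
  · intro T hT
    simp only [Finset.mem_filter, Set.Finite.mem_toFinset] at hT
    obtain ⟨hT, rfl⟩ := hT
    have hle : subShape T n ≤ lam := hmu.le
    have hmem : T.restrict hle ∈ ssytLE (subShape T n) n := by
      rintro ⟨i, j⟩ hc
      have hc : (i, j) ∈ subShape T n := by simpa using hc
      rw [restrict_apply, if_pos hc]
      exact ⟨(hT (i, j) (by simpa using hle hc)).1, (mem_subShape.mp hc).2⟩
    refine ⟨T.restrict hle, by simpa using hmem, ?_⟩
    ext i j
    rw [extend_apply, restrict_apply]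
    by_cases hc : (i, j) ∈ subShape T n
    · simp [hc]
    · rw [if_neg hc]
      by_cases hl : (i, j) ∈ lam
      · rw [if_pos hl]
        have h1 := le_of_mem_ssytLE hT i j
        have h2 : ¬ T i j ≤ n := fun h => hc (mem_subShape.mpr ⟨hl, h⟩)
        omega
      · rw [if_neg hl, T.zeros hl]
  · intro S hS
    rw [sum_extend, pow_add]

end SemistandardYoungTableau

/-! ### The principal specialization of a Schur function -/

section Vandermonde

variable {R : Type*} [CommRing R]

/-- The Vandermonde determinant of the first `n` values of a sequence. -/
def vand (n : ℕ) (v : ℕ → R) : R := (Matrix.vandermonde fun i : Fin n => v i).det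

lemma vand_eq_prod (n : ℕ) (v : ℕ → R) :
    vand n v = ∏ i : Fin n, ∏ j ∈ Finset.Ioi i, (v j - v i) := by
  rw [vand, Matrix.det_vandermonde]

/-- Subtracting from each row its predecessor leaves `1, 0, …, 0` in the first column; expand along
it. -/
lemma vand_succ_eq_det (n : ℕ) (v : ℕ → R) :
    vand (n + 1) v =
      (Matrix.of fun i j : Fin n => v (i + 1) ^ (j + 1 : ℕ) - v i ^ (j + 1 : ℕ)).det := by
  let B : Matrix (Fin (n + 1)) (Fin (n + 1)) R := Matrix.of fun i j =>
    Fin.cases (v 0 ^ (j : ℕ)) (fun i : Fin n => v (i + 1) ^ (j : ℕ) - v i ^ (j : ℕ)) i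
  have h : vand (n + 1) v = B.det := by
    refine Matrix.det_eq_of_forall_row_eq_smul_add_pred (fun _ => 1) ?_ ?_
    · intro j
      simp [B, Matrix.vandermonde]
    · intro i j
      simp [B, Matrix.vandermonde]
  rw [h, Matrix.det_succ_column_zero, Fin.sum_univ_succ]
  have h0 : ∀ i : Fin n, B i.succ 0 = 0 := fun i => by simp [B]
  simp only [h0, mul_zero, zero_mul, Finset.sum_const_zero, add_zero]
  have h1 : B 0 0 = 1 := by simp [B]
  rw [h1]
  simp only [Fin.val_zero, pow_zero, one_mul]
  congr 1

lemma one_sub_pow_mul_sum_Ico (p : R) {a b : ℕ} (hab : a ≤ b) (s : ℕ) :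
    (1 - p ^ s) * ∑ k ∈ Finset.Ico a b, (p ^ k) ^ s = (p ^ a) ^ s - (p ^ b) ^ s := by
  rw [← neg_inj, ← neg_mul, neg_sub, neg_sub, mul_comm]
  simp_rw [← pow_mul, mul_comm _ s, pow_mul]
  exact geom_sum_Ico_mul (p ^ s) hab

/-- Each difference of consecutive rows is a geometric sum over the exponents between `l (i + 1)`
and `l i`. The factors `1 - p ^ (j + 1)` come out of the columns, and multilinearity in the rows
expands the rest into Vandermonde determinants of size `n`. -/
lemma vand_succ_eq_sum (n : ℕ) (p : R) (l : ℕ → ℕ) (hl : ∀ i < n, l (i + 1) ≤ l i) :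
    vand (n + 1) (fun i => p ^ l i) = (∏ j : Fin n, (1 - p ^ (j + 1 : ℕ))) *
      ∑ k ∈ Fintype.piFinset (fun i : Fin n => Finset.Ico (l (i + 1)) (l i)),
        (∏ i, p ^ k i) * (Matrix.vandermonde fun i => p ^ k i).det := by
  rw [vand_succ_eq_det]
  have h1 : (Matrix.of fun i j : Fin n =>
      (p ^ l (i + 1)) ^ (j + 1 : ℕ) - (p ^ l i) ^ (j + 1 : ℕ)) =
      Matrix.of fun i j : Fin n => (1 - p ^ (j + 1 : ℕ)) *
        (∑ k ∈ Finset.Ico (l (i + 1)) (l i), fun j : Fin n => (p ^ k) ^ (j + 1 : ℕ)) j := by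
    ext i j
    simp only [Matrix.of_apply, Finset.sum_apply]
    rw [one_sub_pow_mul_sum_Ico p (hl i i.2)]
  rw [h1]
  refine (Matrix.det_mul_row (fun j : Fin n => 1 - p ^ (j + 1 : ℕ)) (Matrix.of fun i j : Fin n =>
    (∑ k ∈ Finset.Ico (l (i + 1)) (l i), fun j : Fin n => (p ^ k) ^ (j + 1 : ℕ)) j)).trans ?_
  congr 1
  have := (Matrix.detRowAlternating (R := R) (n := Fin n)).toMultilinearMap.map_sum_finset
    (fun (_ : Fin n) (k : ℕ) (j : Fin n) => (p ^ k) ^ (j + 1 : ℕ))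
    (fun i : Fin n => Finset.Ico (l (i + 1)) (l i))
  refine Eq.trans this ?_
  refine Finset.sum_congr rfl fun k _ => ?_
  rw [← Matrix.det_mul_column]
  refine congrArg Matrix.det ?_
  ext i j
  simp [Matrix.vandermonde, pow_succ, mul_comm]

end Vandermonde

/-! ### Interlacing shapes as points of a box -/

namespace YoungDiagram

variable {lam mu : YoungDiagram} {n : ℕ}

lemma card_eq_sum_rowLen (h : mu.rowLen n = 0) : mu.card = ∑ i ∈ Finset.range n, mu.rowLen i := by
  rw [YoungDiagram.card, Finset.card_eq_sum_card_fiberwise (f := Prod.fst) (t := Finset.range n)]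
  · refine Finset.sum_congr rfl fun i _ => ?_
    rw [rowLen_eq_card, row]
  · rintro ⟨i, j⟩ hc
    have hc : (i, j) ∈ mu := by simpa using hc
    rw [mem_iff_lt_rowLen] at hc
    simp only [Finset.coe_range, Set.mem_Iio]
    by_contra! hi
    rw [rowLen_eq_zero_of_le h hi] at hc
    omega

lemma ext_rowLen (h : ∀ i, mu.rowLen i = lam.rowLen i) : mu = lam := by
  apply YoungDiagram.ext
  ext ⟨i, j⟩
  rw [mem_cells, mem_cells, mem_iff_lt_rowLen, mem_iff_lt_rowLen, h]

/-- The strictly decreasing sequence `lam_i + (n - 1 - i)`. -/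
def shifted (lam : YoungDiagram) (n i : ℕ) : ℕ := lam.rowLen i + (n - 1 - i)

lemma shifted_succ_lt {i : ℕ} (hi : i < n) :
    lam.shifted (n + 1) (i + 1) < lam.shifted (n + 1) i := by
  have := lam.rowLen_anti i (i + 1) (Nat.le_succ i)
  simp only [shifted]
  omega

/-- The bound by `lam` keeps the set of cells finite. -/
lemma exists_rowLen_eq (g : ℕ → ℕ) (hg : Antitone g) (hle : ∀ i, g i ≤ lam.rowLen i) :
    ∃ mu : YoungDiagram, ∀ i, mu.rowLen i = g i := by
  let mu : YoungDiagram :=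
    { cells := lam.cells.filter fun c => c.2 < g c.1
      isLowerSet := by
        rintro ⟨i, j⟩ ⟨i', j'⟩ hle h
        simp only [Finset.coe_filter, YoungDiagram.mem_cells, Set.mem_ofPred_eq] at h ⊢
        obtain ⟨hi, hj⟩ := Prod.mk_le_mk.mp hle
        exact ⟨lam.up_left_mem hi hj h.1, (hj.trans_lt h.2).trans_le (hg hi)⟩ }
  have hmem : ∀ i j, (i, j) ∈ mu ↔ j < g i := by
    intro i j
    rw [← mem_cells]
    simp only [mu, Finset.mem_filter, mem_cells, and_iff_right_iff_imp]
    intro h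
    exact mem_iff_lt_rowLen.mpr (h.trans_le (hle i))
  refine ⟨mu, fun i => ?_⟩
  apply le_antisymm
  · by_contra! h
    have := (hmem i _).mp (mem_iff_lt_rowLen.mpr h)
    omega
  · by_contra! h
    have := mem_iff_lt_rowLen.mp ((hmem i _).mpr h)
    omega

/-- After the shift, the weak inequalities of interlacing become independent half-open intervals,
the ranges of summation in `vand_succ_eq_sum`. -/
lemma sum_interlaces {M : Type*} [AddCommMonoid M] (lam : YoungDiagram) (n : ℕ)
    (f : (Fin n → ℕ) → M) :
    ∑ mu ∈ (finite_interlaces lam n).toFinset, f (fun i => mu.shifted n i) =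
      ∑ k ∈ Fintype.piFinset (fun i : Fin n =>
        Finset.Ico (lam.shifted (n + 1) (i + 1)) (lam.shifted (n + 1) i)), f k := by
  refine Finset.sum_bij (fun mu _ i => mu.shifted n i) ?_ ?_ ?_ (fun _ _ => rfl)
  · intro mu hmu
    have hmu : mu.Interlaces lam n := by simpa using hmu
    rw [Fintype.mem_piFinset]
    intro i
    have h1 := hmu.le_row i i.2
    have h2 := hmu.row_le i i.2
    have h3 := i.2
    simp only [Finset.mem_Ico, shifted]
    omega
  · intro mu hmu nu hnu heq
    have hmu : mu.Interlaces lam n := by simpa using hmu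
    have hnu : nu.Interlaces lam n := by simpa using hnu
    apply ext_rowLen
    intro i
    rcases lt_or_ge i n with hi | hi
    · have := congrFun heq ⟨i, hi⟩
      simpa [shifted] using this
    · rw [rowLen_eq_zero_of_le hmu.row_zero hi, rowLen_eq_zero_of_le hnu.row_zero hi]
  · intro k hk
    rw [Fintype.mem_piFinset] at hk
    have hk' : ∀ i (hi : i < n), lam.rowLen (i + 1) + (n - 1 - i) ≤ k ⟨i, hi⟩ ∧
        k ⟨i, hi⟩ ≤ lam.rowLen i + (n - 1 - i) := by
      intro i hi
      have := hk ⟨i, hi⟩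
      simp only [Finset.mem_Ico, shifted] at this
      omega
    let g : ℕ → ℕ := fun i => if hi : i < n then k ⟨i, hi⟩ - (n - 1 - i) else 0
    have hg : ∀ i (hi : i < n), g i = k ⟨i, hi⟩ - (n - 1 - i) := fun i hi => dif_pos hi
    have hg0 : ∀ i, n ≤ i → g i = 0 := fun i hi => dif_neg (by omega)
    have hanti : Antitone g := by
      refine antitone_nat_of_succ_le fun i => ?_
      rcases lt_or_ge (i + 1) n with h | h
      · have h1 := hk' i (by omega)
        have h2 := hk' (i + 1) h
        rw [hg i (by omega), hg (i + 1) h]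
        omega
      · rw [hg0 _ h]
        omega
    have hle : ∀ i, g i ≤ lam.rowLen i := by
      intro i
      rcases lt_or_ge i n with h | h
      · have h1 := hk' i h
        rw [hg i h]
        omega
      · rw [hg0 i h]
        omega
    obtain ⟨mu, hmu⟩ := exists_rowLen_eq g hanti hle
    refine ⟨mu, ?_, ?_⟩
    · simp only [Set.Finite.mem_toFinset]
      refine ⟨fun i hi => ?_, fun i hi => ?_, ?_⟩
      · have := hk' i hi
        rw [hmu, hg i hi]
        omega
      · rw [hmu]
        exact hle i
      · rw [hmu, hg0 n le_rfl]
    · funext i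
      have := hk' i i.2
      simp only [shifted]
      rw [hmu, hg i i.2]
      simp only [Fin.eta] at this ⊢
      omega

end YoungDiagram

namespace SemistandardYoungTableau

variable {lam : YoungDiagram} {n : ℕ} {R : Type*} [CommRing R]

/-- The principal specialization of a Schur function as a ratio of Vandermonde determinants. -/
theorem corankGF_mul_vand (hlam : lam.colLen 0 ≤ n) (p : R) :
    corankGF lam n p * vand n (fun i => p ^ (n - 1 - i)) =
      vand n (fun i => p ^ lam.shifted n i) := by
  induction n generalizing lam with
  | zero =>
    have hlam : lam = ⊥ := by
      apply YoungDiagram.ext_rowLen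
      intro i
      rw [YoungDiagram.rowLen_eq_zero_iff.mpr (hlam.trans (Nat.zero_le i)),
        YoungDiagram.rowLen_eq_zero_iff.mpr]
      simp [YoungDiagram.colLen_eq_card, YoungDiagram.col]
    subst hlam
    have : (finite_ssytLE ⊥ 0).toFinset = {default} := by
      ext T
      simp only [Set.Finite.mem_toFinset, Finset.mem_singleton]
      constructor
      · intro _
        ext i j
        rw [T.zeros (YoungDiagram.notMem_bot _),
          (default : SemistandardYoungTableau ⊥).zeros (YoungDiagram.notMem_bot _)]
      · intro _ c hc
        simp at hc
    simp [corankGF, this, vand]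
  | succ n ih =>
    -- The power of `p` that turns `p ^ mu.card` into the product of all `p ^ mu.shifted n i`.
    let w : R := p ^ ∑ i : Fin n, (n - 1 - (i : ℕ))
    have key : ∀ mu ∈ (YoungDiagram.finite_interlaces lam n).toFinset,
        p ^ mu.card * corankGF mu n p * (w * vand n (fun i => p ^ (n - 1 - i))) =
          (∏ i : Fin n, p ^ mu.shifted n i) *
            (Matrix.vandermonde fun i : Fin n => p ^ mu.shifted n i).det := by
      intro mu hmu
      have hmu : mu.Interlaces lam n := by simpa using hmu
      have h1 : p ^ mu.card * w = ∏ i : Fin n, p ^ mu.shifted n i := by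
        rw [Finset.prod_pow_eq_pow_sum, ← pow_add,
          YoungDiagram.card_eq_sum_rowLen hmu.row_zero, ← Fin.sum_univ_eq_sum_range,
          ← Finset.sum_add_distrib]
        rfl
      have h2 := ih (YoungDiagram.rowLen_eq_zero_iff.mp hmu.row_zero)
      rw [← h1]
      change _ = _ * vand n (fun i => p ^ mu.shifted n i)
      rw [← h2]
      ring
    have h1 : ∀ nu : YoungDiagram, vand (n + 1) (fun i => p ^ nu.shifted (n + 1) i) =
        (∏ j : Fin n, (1 - p ^ (j + 1 : ℕ))) *
        ∑ mu ∈ (YoungDiagram.finite_interlaces nu n).toFinset,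
          (∏ i : Fin n, p ^ mu.shifted n i) *
            (Matrix.vandermonde fun i : Fin n => p ^ mu.shifted n i).det := by
      intro nu
      rw [vand_succ_eq_sum n p _ (fun i hi => (nu.shifted_succ_lt hi).le),
        ← YoungDiagram.sum_interlaces nu n
          (fun k => (∏ i, p ^ k i) * (Matrix.vandermonde fun i => p ^ k i).det)]
    have hbot : ∀ i, (⊥ : YoungDiagram).rowLen i = 0 := fun i => by
      simp [YoungDiagram.rowLen_eq_card, YoungDiagram.row]
    -- Only the empty shape interlaces the empty shape, so the same expansion gives a one-term
    -- recursion for the denominator. The factors `1 - p ^ (j + 1)` then occur on both sides, and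
    -- nothing has to be divided.
    have h2 : (YoungDiagram.finite_interlaces ⊥ n).toFinset = {⊥} := by
      ext mu
      simp only [Set.Finite.mem_toFinset, Finset.mem_singleton]
      constructor
      · intro h
        exact le_bot_iff.mp (YoungDiagram.Interlaces.le h)
      · rintro rfl
        exact ⟨fun i _ => by simp [hbot], fun i _ => by simp [hbot], hbot n⟩
    have h3 := h1 ⊥
    simp only [h2, Finset.sum_singleton, YoungDiagram.shifted, hbot, zero_add] at h3
    rw [h3, h1 lam, ← Finset.sum_congr rfl key, ← Finset.sum_mul, ← corankGF_succ hlam,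
      Finset.prod_pow_eq_pow_sum]
    simp only [w, vand]
    ring

end SemistandardYoungTableau

/-! ### The function `sinh x / x` and the derivatives of its logarithm at zero -/

namespace Real

open scoped ContDiff

/-- The function `sinh x / x`, with the value `1` at `0`. -/
noncomputable def sinhc : ℝ → ℝ := dslope sinh 0

lemma sinhc_zero : sinhc 0 = 1 := by
  simp [sinhc, dslope_same]

lemma sinhc_of_ne_zero {x : ℝ} (hx : x ≠ 0) : sinhc x = sinh x / x := by
  rw [sinhc, dslope_of_ne _ hx, slope_def_field, sinh_zero, sub_zero, sub_zero]

lemma mul_sinhc (x : ℝ) : x * sinhc x = sinh x := by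
  rcases eq_or_ne x 0 with rfl | hx
  · simp
  · rw [sinhc_of_ne_zero hx, mul_div_cancel₀ _ hx]

lemma sinhc_pos (x : ℝ) : 0 < sinhc x := by
  rcases lt_trichotomy x 0 with hx | rfl | hx
  · rw [sinhc_of_ne_zero hx.ne]
    exact div_pos_of_neg_of_neg (sinh_neg_iff.mpr hx) hx
  · simp [sinhc_zero]
  · rw [sinhc_of_ne_zero hx.ne']
    exact div_pos (sinh_pos_iff.mpr hx) hx

lemma contDiff_sinhc : ContDiff ℝ ∞ sinhc := by
  rw [contDiff_iff_contDiffAt]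
  intro x
  rcases eq_or_ne x 0 with rfl | hx
  · obtain ⟨p, hp⟩ : AnalyticAt ℝ sinh 0 := analyticAt_sinh
    exact AnalyticAt.contDiffAt ⟨_, hp.has_fpower_series_dslope_fslope⟩
  · have h1 : ContDiffAt ℝ ∞ (fun x => sinh x / x) x :=
      contDiff_sinh.contDiffAt.div contDiffAt_id hx
    refine h1.congr_of_eventuallyEq ?_
    filter_upwards [isOpen_ne.mem_nhds hx] with y hy using sinhc_of_ne_zero hy

/-- The logarithm of `sinh x / x`. -/
noncomputable def logSinhc (x : ℝ) : ℝ := log (sinhc x)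

lemma contDiff_logSinhc : ContDiff ℝ ∞ logSinhc :=
  contDiff_sinhc.log fun x => (sinhc_pos x).ne'

lemma contDiff_deriv_logSinhc : ContDiff ℝ ∞ (deriv logSinhc) := by
  simpa using contDiff_logSinhc.iterate_deriv 1

/-- The Riccati equation of `coth x - 1 / x`. -/
lemma deriv_logSinhc_riccati (x : ℝ) :
    x * deriv (deriv logSinhc) x + 2 * deriv logSinhc x + x * (deriv logSinhc x * deriv logSinhc x)
      = x := by
  have hd : Differentiable ℝ sinhc := contDiff_sinhc.differentiable (by simp)
  have hcd : ContDiff ℝ ∞ (deriv sinhc) := by simpa using contDiff_sinhc.iterate_deriv 1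
  have hd' : Differentiable ℝ (deriv sinhc) := hcd.differentiable (by simp)
  have hs : ∀ x, sinhc x ≠ 0 := fun x => (sinhc_pos x).ne'
  have hw : deriv logSinhc = fun x => deriv sinhc x / sinhc x := by
    funext x
    exact ((hd x).hasDerivAt.log (hs x)).deriv
  have hw' : deriv (deriv logSinhc) x =
      (deriv (deriv sinhc) x * sinhc x - deriv sinhc x * deriv sinhc x) / sinhc x ^ 2 := by
    rw [hw]
    exact ((hd' x).hasDerivAt.div (hd x).hasDerivAt (hs x)).deriv
  -- Differentiating `x * sinhc x = sinh x` once, and then again in `e2`, gives the linear equation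
  -- behind the Riccati equation.
  have e1 : (fun x => sinhc x + x * deriv sinhc x) = cosh := by
    funext y
    have h1 : HasDerivAt (fun x => x * sinhc x) (1 * sinhc y + y * deriv sinhc y) y :=
      (hasDerivAt_id y).mul (hd y).hasDerivAt
    have h2 : (fun x => x * sinhc x) = sinh := funext mul_sinhc
    rw [h2] at h1
    rw [← h1.unique (hasDerivAt_sinh y), one_mul]
  have e2 : 2 * deriv sinhc x + x * deriv (deriv sinhc) x = x * sinhc x := by
    have h1 : HasDerivAt (fun x => sinhc x + x * deriv sinhc x)
        (deriv sinhc x + (1 * deriv sinhc x + x * deriv (deriv sinhc) x)) x :=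
      (hd x).hasDerivAt.add ((hasDerivAt_id x).mul (hd' x).hasDerivAt)
    rw [e1] at h1
    rw [mul_sinhc, ← h1.unique (hasDerivAt_cosh x)]
    ring
  rw [hw', hw]
  field_simp [hs x]
  linear_combination sinhc x * e2

/-- In the Leibniz formula at `0` only the first derivative of `x` survives. For `n = 0` the factor
`n` makes the truncated `n - 1` harmless. -/
lemma iteratedDeriv_id_mul_zero {g : ℝ → ℝ} (hg : ContDiff ℝ ∞ g) (n : ℕ) :
    iteratedDeriv n (fun x => x * g x) 0 = n * iteratedDeriv (n - 1) g 0 := by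
  have hid : ContDiffAt ℝ n (fun x : ℝ => x) 0 := contDiffAt_id
  rw [iteratedDeriv_fun_mul hid (hg.contDiffAt.of_le (by exact_mod_cast le_top))]
  rcases n with _ | n
  · simp
  · rw [Finset.sum_eq_single 1]
    · simp [iteratedDeriv_fun_id_zero]
    · intro i _ hi
      simp [iteratedDeriv_fun_id_zero, hi]
    · simp

/-- The `n`-th derivative at `0` of the Riccati equation: a quadratic recursion for the Taylor
coefficients. -/
lemma iteratedDeriv_deriv_logSinhc_rec (n : ℕ) :
    (n + 2) * iteratedDeriv n (deriv logSinhc) 0 + n * ∑ i ∈ Finset.range (n - 1 + 1),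
      ((n - 1).choose i : ℝ) * iteratedDeriv i (deriv logSinhc) 0 *
        iteratedDeriv (n - 1 - i) (deriv logSinhc) 0 = if n = 1 then 1 else 0 := by
  set w := deriv logSinhc with hw
  have hcw : ContDiff ℝ ∞ w := contDiff_deriv_logSinhc
  have hcw' : ContDiff ℝ ∞ (deriv w) := by simpa using hcw.iterate_deriv 1
  have hle : ∀ n : ℕ, (n : WithTop ℕ∞) ≤ (∞ : WithTop ℕ∞) := fun n => by exact_mod_cast le_top
  have h1 : (fun x => x * deriv w x + 2 * w x + x * (w x * w x)) = fun x => x :=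
    funext deriv_logSinhc_riccati
  have h2 := congrArg (fun f => iteratedDeriv n f 0) h1
  simp only [iteratedDeriv_fun_id_zero] at h2
  have c1 : ContDiffAt ℝ n (fun x => x * deriv w x) 0 :=
    (contDiff_id.mul hcw').contDiffAt.of_le (hle n)
  have c2 : ContDiffAt ℝ n (fun x => 2 * w x) 0 :=
    (contDiff_const.mul hcw).contDiffAt.of_le (hle n)
  have c3 : ContDiffAt ℝ n (fun x => x * (w x * w x)) 0 :=
    (contDiff_id.mul (hcw.mul hcw)).contDiffAt.of_le (hle n)
  rw [iteratedDeriv_fun_add (c1.add c2) c3, iteratedDeriv_fun_add c1 c2,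
    iteratedDeriv_id_mul_zero hcw', iteratedDeriv_id_mul_zero (hcw.mul hcw),
    iteratedDeriv_const_mul_field,
    iteratedDeriv_fun_mul (hcw.contDiffAt.of_le (hle _)) (hcw.contDiffAt.of_le (hle _))] at h2
  rw [← h2]
  rcases n with _ | n
  · simp
  · rw [iteratedDeriv_succ' (f := w)]
    simp only [Nat.add_sub_cancel]
    push_cast
    ring

/-- The even derivatives of `coth x - 1 / x` vanish at `0` and the odd ones alternate in sign. -/
lemma iteratedDeriv_deriv_logSinhc_sign (n : ℕ) :
    (Even n → iteratedDeriv n (deriv logSinhc) 0 = 0) ∧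
    (Odd n → 0 < (-1 : ℝ) ^ (n / 2) * iteratedDeriv n (deriv logSinhc) 0) := by
  induction n using Nat.strong_induction_on with
  | _ n ih =>
    have hrec := iteratedDeriv_deriv_logSinhc_rec n
    set D : ℕ → ℝ := fun n => iteratedDeriv n (deriv logSinhc) 0 with hD
    change (Even n → D n = 0) ∧ (Odd n → 0 < (-1 : ℝ) ^ (n / 2) * D n)
    replace ih : ∀ m < n, (Even m → D m = 0) ∧ (Odd m → 0 < (-1 : ℝ) ^ (m / 2) * D m) := ih
    replace hrec : (n + 2) * D n + n * ∑ i ∈ Finset.range (n - 1 + 1),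
      ((n - 1).choose i : ℝ) * D i * D (n - 1 - i) = if n = 1 then 1 else 0 := hrec
    have hn2 : (0 : ℝ) < n + 2 := by positivity
    constructor
    · intro he
      have hz : n * ∑ i ∈ Finset.range (n - 1 + 1),
          ((n - 1).choose i : ℝ) * D i * D (n - 1 - i) = 0 := by
        rcases Nat.eq_zero_or_pos n with rfl | hpos
        · simp
        rw [Finset.sum_eq_zero, mul_zero]
        intro i hi
        rw [Finset.mem_range] at hi
        rcases Nat.even_or_odd i with h | h
        · rw [(ih i (by omega)).1 h]
          simp
        · rw [(ih (n - 1 - i) (by omega)).1 (by grind)]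
          simp
      rw [hz, if_neg (by rintro rfl; simp at he), add_zero] at hrec
      exact (mul_eq_zero.mp hrec).resolve_left hn2.ne'
    · intro ho
      rcases eq_or_ne n 1 with rfl | hn1
      · have h0 : D 0 = 0 := (ih 0 (by omega)).1 (by simp)
        simp [h0] at hrec
        norm_num
        linarith
      · have hn3 : 3 ≤ n := by grind
        -- Only odd `i` contribute. There the signs of the two lower derivatives multiply to `(-1) ^
        -- (n / 2 + 1)`, the opposite of the sign claimed for `D n`, and the recursion negates the
        -- sum. The term `i = 1` makes the sum strictly positive.
        have hterm : ∀ i ∈ Finset.range (n - 1 + 1), 0 ≤ (-1 : ℝ) ^ (n / 2 + 1) *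
            (((n - 1).choose i : ℝ) * D i * D (n - 1 - i)) ∧ (i = 1 → 0 < (-1 : ℝ) ^ (n / 2 + 1) *
            (((n - 1).choose i : ℝ) * D i * D (n - 1 - i))) := by
          intro i hi
          rw [Finset.mem_range] at hi
          rcases Nat.even_or_odd i with h | h
          · rw [(ih i (by omega)).1 h]
            simp
            rintro rfl
            simp at h
          · have h' : Odd (n - 1 - i) := by grind
            have h1 := (ih i (by omega)).2 h
            have h2 := (ih (n - 1 - i) (by omega)).2 h'
            have h3 : (0 : ℝ) < (n - 1).choose i := by
              exact_mod_cast Nat.choose_pos (by omega)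
            have h4 : (-1 : ℝ) ^ (n / 2 + 1) = (-1) ^ (i / 2) * (-1) ^ ((n - 1 - i) / 2) := by
              rw [← pow_add]
              have : n / 2 + 1 = i / 2 + (n - 1 - i) / 2 + 2 := by grind
              rw [this, pow_add]
              norm_num
            have h5 : 0 < (-1 : ℝ) ^ (n / 2 + 1) *
                (((n - 1).choose i : ℝ) * D i * D (n - 1 - i)) := by
              rw [h4]
              have := mul_pos h3 (mul_pos h1 h2)
              linarith
            exact ⟨h5.le, fun _ => h5⟩
        have hsum : 0 < ∑ i ∈ Finset.range (n - 1 + 1), (-1 : ℝ) ^ (n / 2 + 1) *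
            (((n - 1).choose i : ℝ) * D i * D (n - 1 - i)) :=
          Finset.sum_pos' (fun i hi => (hterm i hi).1)
            ⟨1, by simp; omega, (hterm 1 (by simp; omega)).2 rfl⟩
        rw [← Finset.mul_sum, pow_succ] at hsum
        rw [if_neg hn1] at hrec
        have hn0 : (0 : ℝ) < n := by exact_mod_cast (by omega : 0 < n)
        have := mul_pos hn0 hsum
        have : 0 < (n + 2) * ((-1 : ℝ) ^ (n / 2) * D n) := by
          have e : (n + 2) * ((-1 : ℝ) ^ (n / 2) * D n) =
            (-1 : ℝ) ^ (n / 2) * ((n + 2) * D n) := by ring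
          rw [e, eq_neg_of_add_eq_zero_left hrec]
          linarith
        exact (mul_pos_iff_of_pos_left hn2).mp this

lemma iteratedDeriv_logSinhc_pos {d : ℕ} (hd : 2 ≤ d) (he : Even d) :
    0 < (-1 : ℝ) ^ (d / 2 + 1) * iteratedDeriv d logSinhc 0 := by
  obtain ⟨n, rfl⟩ : ∃ n, d = n + 1 := ⟨d - 1, by omega⟩
  rw [iteratedDeriv_succ']
  have h := (iteratedDeriv_deriv_logSinhc_sign n).2 (by grind)
  have : (n + 1) / 2 + 1 = n / 2 + 2 := by grind
  rw [this, pow_add]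
  linarith

lemma deriv_logSinhc_zero : deriv logSinhc 0 = 0 := by
  simpa using (iteratedDeriv_deriv_logSinhc_sign 0).1 (by simp)

lemma iteratedDeriv_two_logSinhc : iteratedDeriv 2 logSinhc 0 = 1 / 3 := by
  have h := iteratedDeriv_deriv_logSinhc_rec 1
  simp [deriv_logSinhc_zero] at h
  rw [iteratedDeriv_succ', iteratedDeriv_one]
  linarith

end Real

/-! ### The moment generating function of the rank -/

namespace Complex

/-- The entire function `sinh z / z`, with the value `1` at `0`. -/
noncomputable def sinhc : ℂ → ℂ := dslope sinh 0

lemma sinhc_of_ne_zero {z : ℂ} (hz : z ≠ 0) : sinhc z = sinh z / z := by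
  rw [sinhc, dslope_of_ne _ hz, slope_def_field, sinh_zero, sub_zero, sub_zero]

lemma sinhc_zero : sinhc 0 = 1 := by
  simp [sinhc, dslope_same]

lemma mul_sinhc (z : ℂ) : z * sinhc z = sinh z := by
  rcases eq_or_ne z 0 with rfl | hz
  · simp
  · rw [sinhc_of_ne_zero hz, mul_div_cancel₀ _ hz]

lemma continuous_sinhc : Continuous sinhc := by
  rw [continuous_iff_continuousAt]
  intro z
  rcases eq_or_ne z 0 with rfl | hz
  · exact continuousAt_dslope_same.mpr differentiable_sinh.differentiableAt
  · exact (continuousAt_dslope_of_ne hz).mpr continuous_sinh.continuousAt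

lemma sinhc_ofReal (x : ℝ) : sinhc x = (Real.sinhc x : ℂ) := by
  rcases eq_or_ne x 0 with rfl | hx
  · simp [sinhc_zero, Real.sinhc_zero]
  · rw [sinhc_of_ne_zero (by exact_mod_cast hx), Real.sinhc_of_ne_zero hx]
    simp

lemma sinhc_ofReal_mul_I (x : ℝ) : sinhc (x * I) = (Real.sinc x : ℂ) := by
  rcases eq_or_ne x 0 with rfl | hx
  · simp [sinhc_zero]
  · rw [sinhc_of_ne_zero (mul_ne_zero (by exact_mod_cast hx) I_ne_zero), sinh_mul_I,
      mul_div_mul_right _ _ I_ne_zero, Real.sinc_of_ne_zero hx]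
    simp

end Complex

/-- The pairs `i < j` of natural numbers below `n`. -/
def ltPairs (n : ℕ) : Finset (ℕ × ℕ) :=
  (Finset.range n ×ˢ Finset.range n).filter fun x => x.1 < x.2

lemma mem_ltPairs {n : ℕ} {x : ℕ × ℕ} : x ∈ ltPairs n ↔ x.1 < x.2 ∧ x.2 < n := by
  simp only [ltPairs, Finset.mem_filter, Finset.mem_product, Finset.mem_range]
  omega

lemma vand_eq_prod_ltPairs {R : Type*} [CommRing R] (n : ℕ) (v : ℕ → R) :
    vand n v = ∏ x ∈ ltPairs n, (v x.2 - v x.1) := by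
  rw [vand_eq_prod, ltPairs, Finset.prod_filter, Finset.prod_product,
    ← Fin.prod_univ_eq_prod_range (fun i => ∏ j ∈ Finset.range n,
      if i < j then v j - v i else 1)]
  refine Finset.prod_congr rfl fun i _ => ?_
  rw [← Fin.prod_univ_eq_prod_range (fun j => if (i : ℕ) < j then v j - v i else 1),
    ← Finset.prod_filter]
  refine Finset.prod_congr ?_ fun _ _ => rfl
  ext j
  simp

/-- Taking the mean exponent out of `e^(-zb) - e^(-za)` leaves `2 sinh (z (a - b) / 2)`. Writing
this as `z (a - b)` times an entire function isolates the zero at `z = 0`. -/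
lemma vand_exp (n : ℕ) (l : ℕ → ℕ) (z : ℂ) :
    vand n (fun i => Complex.exp (-z) ^ l i) =
      Complex.exp (-(z * ∑ x ∈ ltPairs n, ((l x.1 : ℂ) + l x.2) / 2)) * z ^ (ltPairs n).card *
        ((∏ x ∈ ltPairs n, ((l x.1 : ℂ) - l x.2)) *
          ∏ x ∈ ltPairs n, Complex.sinhc (z * ((l x.1 : ℂ) - l x.2) / 2)) := by
  rw [vand_eq_prod_ltPairs, Finset.mul_sum, ← Finset.sum_neg_distrib, Complex.exp_sum,
    ← Finset.prod_const, ← Finset.prod_mul_distrib, ← Finset.prod_mul_distrib,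
    ← Finset.prod_mul_distrib]
  refine Finset.prod_congr rfl fun x _ => ?_
  have h : ∀ a b : ℂ, Complex.exp (b * -z) - Complex.exp (a * -z) =
      Complex.exp (-(z * ((a + b) / 2))) * z * ((a - b) * Complex.sinhc (z * (a - b) / 2)) := by
    intro a b
    have h1 : z * ((a - b) * Complex.sinhc (z * (a - b) / 2)) =
        2 * Complex.sinh (z * (a - b) / 2) := by
      rw [← Complex.mul_sinhc]
      ring
    rw [mul_assoc, h1, Complex.sinh]
    have h2 : b * -z = -(z * ((a + b) / 2)) + z * (a - b) / 2 := by ring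
    have h3 : a * -z = -(z * ((a + b) / 2)) + -(z * (a - b) / 2) := by ring
    rw [h2, h3, Complex.exp_add, Complex.exp_add]
    ring
  rw [← Complex.exp_nat_mul, ← Complex.exp_nat_mul, h]

namespace YoungDiagram

/-- The difference `(lam_i - i) - (lam_j - j)`. -/
noncomputable def gap (lam : YoungDiagram) (x : ℕ × ℕ) : ℝ :=
  ((lam.rowLen x.1 : ℝ) - lam.rowLen x.2) + ((x.2 : ℝ) - x.1)

/-- The difference `j - i` of row indices. -/
noncomputable def rowDist (x : ℕ × ℕ) : ℝ := (x.2 : ℝ) - x.1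

lemma one_le_rowDist {n : ℕ} {x : ℕ × ℕ} (hx : x ∈ ltPairs n) : 1 ≤ rowDist x := by
  have h : x.1 + 1 ≤ x.2 := (mem_ltPairs.mp hx).1
  have h : (x.1 : ℝ) + 1 ≤ x.2 := by exact_mod_cast h
  rw [rowDist]
  linarith

lemma rowDist_le_gap (lam : YoungDiagram) {n : ℕ} {x : ℕ × ℕ} (hx : x ∈ ltPairs n) :
    rowDist x ≤ lam.gap x := by
  have h : lam.rowLen x.2 ≤ lam.rowLen x.1 := lam.rowLen_anti _ _ (mem_ltPairs.mp hx).1.le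
  have h : (lam.rowLen x.2 : ℝ) ≤ lam.rowLen x.1 := by exact_mod_cast h
  rw [rowDist, gap]
  linarith

lemma shifted_sub_shifted (lam : YoungDiagram) {n : ℕ} {x : ℕ × ℕ} (hx : x ∈ ltPairs n) :
    (lam.shifted n x.1 : ℝ) - lam.shifted n x.2 = lam.gap x := by
  have h := mem_ltPairs.mp hx
  have h1 : ((n - 1 - x.1 : ℕ) : ℝ) = n - 1 - x.1 := by
    rw [Nat.cast_sub (by omega), Nat.cast_sub (by omega)]
    simp
  have h2 : ((n - 1 - x.2 : ℕ) : ℝ) = n - 1 - x.2 := by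
    rw [Nat.cast_sub (by omega), Nat.cast_sub (by omega)]
    simp
  rw [shifted, shifted, gap]
  push_cast [h1, h2]
  ring

end YoungDiagram

namespace SemistandardYoungTableau

open YoungDiagram

variable {lam : YoungDiagram} {n : ℕ}

lemma ssytRank_eq_sum (T : SemistandardYoungTableau lam) :
    ssytRank T = ∑ c ∈ lam.cells, (T c.1 c.2 - 1) := by
  classical
  rw [ssytRank, finsum_eq_sum_of_support_subset (s := lam.cells.image fun c => T c.1 c.2)]
  · rw [Finset.sum_comp (fun i => i - 1) (fun c : ℕ × ℕ => T c.1 c.2)]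
    simp [ssytType, mul_comm]
  · intro i hi
    have h := right_ne_zero_of_mul (Function.mem_support.mp hi)
    obtain ⟨c, hc⟩ := Finset.card_pos.mp (Nat.pos_of_ne_zero h)
    rw [Finset.mem_filter] at hc
    exact Finset.mem_coe.mpr (Finset.mem_image.mpr ⟨c, hc.1, hc.2⟩)

lemma ssytRank_add_corank {T : SemistandardYoungTableau lam} (hT : T ∈ ssytLE lam n) :
    ssytRank T + ∑ c ∈ lam.cells, (n - T c.1 c.2) = lam.card * (n - 1) := by
  rw [ssytRank_eq_sum, ← Finset.sum_add_distrib, Finset.sum_congr rfl (g := fun _ => n - 1)]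
  · simp
  · intro c hc
    have := hT c hc
    omega

/-- The generating function of the rank. -/
noncomputable def rankGF (lam : YoungDiagram) (n : ℕ) (z : ℂ) : ℂ :=
  ∑ T ∈ (finite_ssytLE lam n).toFinset, Complex.exp (z * ssytRank T)

lemma rankGF_eq (z : ℂ) : rankGF lam n z =
    Complex.exp (z * (lam.card * (n - 1) : ℕ)) * corankGF lam n (Complex.exp (-z)) := by
  rw [rankGF, corankGF, Finset.mul_sum]
  refine Finset.sum_congr rfl fun T hT => ?_
  rw [← ssytRank_add_corank (n := n) (T := T) (by simpa using hT), ← Complex.exp_nat_mul,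
    ← Complex.exp_add]
  congr 1
  push_cast
  ring

/-- Apply `vand_exp` to numerator and denominator, whose exponents are the shifted rows of `lam` and
of the empty shape. Both carry the same power of `z`. -/
lemma exists_rankGF_mul (hlam : lam.colLen 0 ≤ n) : ∃ c : ℝ, ∀ z : ℂ,
    rankGF lam n z * ((∏ x ∈ ltPairs n, (rowDist x : ℂ)) *
      ∏ x ∈ ltPairs n, Complex.sinhc (z * rowDist x / 2)) =
    Complex.exp (c * z) * ((∏ x ∈ ltPairs n, (lam.gap x : ℂ)) *
      ∏ x ∈ ltPairs n, Complex.sinhc (z * lam.gap x / 2)) := by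
  let A : YoungDiagram → ℝ := fun nu =>
    ∑ x ∈ ltPairs n, ((nu.shifted n x.1 : ℝ) + nu.shifted n x.2) / 2
  have hbot : ∀ i, (⊥ : YoungDiagram).rowLen i = 0 := fun i => by
    simp [YoungDiagram.rowLen_eq_card, YoungDiagram.row]
  have hv : ∀ (nu : YoungDiagram) (z : ℂ),
      vand n (fun i => Complex.exp (-z) ^ nu.shifted n i) =
      Complex.exp (-(z * A nu)) * z ^ (ltPairs n).card * ((∏ x ∈ ltPairs n, (nu.gap x : ℂ)) *
      ∏ x ∈ ltPairs n, Complex.sinhc (z * nu.gap x / 2)) := by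
    intro nu z
    have h : ∀ x ∈ ltPairs n,
        ((nu.shifted n x.1 : ℂ) - nu.shifted n x.2) = (nu.gap x : ℂ) := by
      intro x hx
      rw [← shifted_sub_shifted nu hx]
      push_cast
      rfl
    have h' : ∏ x ∈ ltPairs n,
          Complex.sinhc (z * ((nu.shifted n x.1 : ℂ) - nu.shifted n x.2) / 2) =
        ∏ x ∈ ltPairs n, Complex.sinhc (z * nu.gap x / 2) :=
      Finset.prod_congr rfl fun x hx => by rw [h x hx]
    rw [vand_exp, Finset.prod_congr rfl h, h']
    simp [A]
  have hgap : ∀ x, (⊥ : YoungDiagram).gap x = rowDist x := fun x => by simp [gap, rowDist, hbot]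
  refine ⟨(lam.card * (n - 1) : ℕ) - A lam + A ⊥, ?_⟩
  intro z
  revert z
  rw [← funext_iff]
  have hcs := Complex.continuous_sinhc
  -- Cancelling the power of `z` needs `z ≠ 0`; the value at `0` follows by continuity.
  refine Continuous.ext_on (dense_compl_singleton (0 : ℂ)) ?_ ?_ ?_
  · unfold rankGF
    fun_prop
  · fun_prop
  · intro z hz
    have hz : z ≠ 0 := hz
    have h := corankGF_mul_vand hlam (Complex.exp (-z))
    have h0 : (fun i => Complex.exp (-z) ^ (n - 1 - i)) =
        fun i => Complex.exp (-z) ^ (⊥ : YoungDiagram).shifted n i := by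
      funext i
      simp [shifted, hbot]
    rw [h0, hv, hv] at h
    simp only [hgap] at h
    have hne : Complex.exp (-(z * A ⊥)) * z ^ (ltPairs n).card ≠ 0 :=
      mul_ne_zero (Complex.exp_ne_zero _) (pow_ne_zero _ hz)
    apply mul_left_cancel₀ hne
    beta_reduce
    set P := (∏ x ∈ ltPairs n, (rowDist x : ℂ)) *
      ∏ x ∈ ltPairs n, Complex.sinhc (z * rowDist x / 2)
    set Q := (∏ x ∈ ltPairs n, (lam.gap x : ℂ)) *
      ∏ x ∈ ltPairs n, Complex.sinhc (z * lam.gap x / 2)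
    have hexp : Complex.exp (-(z * A ⊥)) *
        Complex.exp ((((lam.card * (n - 1) : ℕ) - A lam + A ⊥ : ℝ) : ℂ) * z) =
        Complex.exp (z * (lam.card * (n - 1) : ℕ)) * Complex.exp (-(z * A lam)) := by
      rw [← Complex.exp_add, ← Complex.exp_add]
      congr 1
      push_cast
      ring
    rw [rankGF_eq]
    linear_combination Complex.exp (z * (lam.card * (n - 1) : ℕ)) * h -
      z ^ (ltPairs n).card * Q * hexp

lemma rankGF_zero : rankGF lam n 0 = (finite_ssytLE lam n).toFinset.card := by
  simp [rankGF]

lemma rankGF_zero_mul (hlam : lam.colLen 0 ≤ n) :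
    rankGF lam n 0 * ∏ x ∈ ltPairs n, (rowDist x : ℂ) = ∏ x ∈ ltPairs n, (lam.gap x : ℂ) := by
  obtain ⟨c, hc⟩ := exists_rankGF_mul hlam
  simpa [Complex.sinhc_zero] using hc 0

/-- At `z = 0` the identity is the product formula for the number of tableaux, and all gaps are
positive; no tableau has to be exhibited. -/
lemma nonempty_ssytLE (hlam : lam.colLen 0 ≤ n) : (ssytLE lam n).Nonempty := by
  by_contra h
  rw [Set.not_nonempty_iff_eq_empty] at h
  have h1 := rankGF_zero_mul hlam
  have h2 : rankGF lam n 0 = 0 := by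
    rw [rankGF_zero]
    simp [h]
  rw [h2, zero_mul] at h1
  obtain ⟨x, hx, h3⟩ := Finset.prod_eq_zero_iff.mp h1.symm
  have h4 := one_le_rowDist hx
  have h5 := rowDist_le_gap lam hx
  have h6 : lam.gap x = 0 := by exact_mod_cast h3
  linarith

lemma isProbabilityMeasure_ssytUniform (hlam : lam.colLen 0 ≤ n) :
    IsProbabilityMeasure (ssytUniform lam n) :=
  isProbabilityMeasure_uniformOn (finite_ssytLE lam n) (nonempty_ssytLE hlam)

variable {E : Type*} [NormedAddCommGroup E]

instance : MeasurableSingletonClass (SemistandardYoungTableau lam) := ⟨fun _ => trivial⟩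

lemma integrableOn_count (f : SemistandardYoungTableau lam → E) :
    IntegrableOn f (ssytLE lam n) Measure.count := by
  have hfin := finite_ssytLE lam n
  have : IsFiniteMeasure (Measure.count.restrict (ssytLE lam n)) :=
    isFiniteMeasure_restrict.mpr (Measure.count_apply_lt_top.mpr hfin).ne
  have h : IntegrableOn f (ssytLE lam n) (Measure.count.restrict (ssytLE lam n)) :=
    IntegrableOn.of_finite hfin
  rwa [IntegrableOn, Measure.restrict_restrict hfin.measurableSet, Set.inter_self] at h

lemma integrable_ssytUniform (f : SemistandardYoungTableau lam → E) :
    Integrable f (ssytUniform lam n) := by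
  rw [ssytUniform, uniformOn, ProbabilityTheory.cond]
  rcases (ssytLE lam n).eq_empty_or_nonempty with h | h
  · simp [h]
  · exact (integrableOn_count f).integrable.smul_measure (by simp [h.ne_empty])

lemma integral_ssytUniform [NormedSpace ℝ E] [CompleteSpace E]
    (f : SemistandardYoungTableau lam → E) : ∫ T, f T ∂(ssytUniform lam n) =
      ((finite_ssytLE lam n).toFinset.card : ℝ)⁻¹ • ∑ T ∈ (finite_ssytLE lam n).toFinset, f T := by
  have hfin := finite_ssytLE lam n
  have h1 := integrableOn_count (n := n) f
  rw [← hfin.coe_toFinset] at h1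
  have h2 := setIntegral_finset _ h1
  rw [hfin.coe_toFinset] at h2
  rw [ssytUniform, uniformOn, ProbabilityTheory.cond, integral_smul_measure, h2,
    Measure.count_apply_finite _ hfin]
  simp [measureReal_def]

lemma exists_complexMGF_mul (hlam : lam.colLen 0 ≤ n) : ∃ c : ℝ, ∀ z : ℂ,
    complexMGF (ssytRankRV lam) (ssytUniform lam n) z *
      ∏ x ∈ ltPairs n, Complex.sinhc (z * rowDist x / 2) =
    Complex.exp (c * z) * ∏ x ∈ ltPairs n, Complex.sinhc (z * lam.gap x / 2) := by
  obtain ⟨c, hc⟩ := exists_rankGF_mul hlam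
  refine ⟨c, fun z => ?_⟩
  have h1 : complexMGF (ssytRankRV lam) (ssytUniform lam n) z =
      (rankGF lam n 0)⁻¹ * rankGF lam n z := by
    rw [complexMGF, integral_ssytUniform, rankGF_zero, rankGF, Complex.real_smul]
    simp [ssytRankRV]
  have hd : ∏ x ∈ ltPairs n, (rowDist x : ℂ) ≠ 0 := by
    rw [Finset.prod_ne_zero_iff]
    intro x hx
    have := one_le_rowDist hx
    exact_mod_cast (by linarith : rowDist x ≠ 0)
  have hG : rankGF lam n 0 ≠ 0 := by
    rw [rankGF_zero]
    have := nonempty_ssytLE hlam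
    simpa using this.ne_empty
  have h2 := hc z
  rw [← rankGF_zero_mul hlam] at h2
  rw [h1]
  apply mul_left_cancel₀ hG
  apply mul_left_cancel₀ hd
  have h3 := mul_inv_cancel₀ hG
  linear_combination h2 + (∏ x ∈ ltPairs n, (rowDist x : ℂ)) * rankGF lam n z *
    (∏ x ∈ ltPairs n, Complex.sinhc (z * rowDist x / 2)) * h3

end SemistandardYoungTableau

/-! ### The cumulants and the characteristic function of the rank -/

namespace SemistandardYoungTableau

open YoungDiagram

variable {lam : YoungDiagram} {n : ℕ}

/-- The real and imaginary axes share one constant `c`, so that the mean, found from the first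
formula, cancels the phase in the second. -/
lemma exists_cgf_eq (hlam : lam.colLen 0 ≤ n) : ∃ c : ℝ,
    (cgf (ssytRankRV lam) (ssytUniform lam n) = fun t => c * t +
      ∑ x ∈ ltPairs n, (Real.logSinhc (lam.gap x / 2 * t) - Real.logSinhc (rowDist x / 2 * t))) ∧
    ∀ t : ℝ, complexMGF (ssytRankRV lam) (ssytUniform lam n) (t * Complex.I) *
        ∏ x ∈ ltPairs n, (Real.sinc (rowDist x / 2 * t) : ℂ) =
      Complex.exp (c * (t * Complex.I)) *
        ∏ x ∈ ltPairs n, (Real.sinc (lam.gap x / 2 * t) : ℂ) := by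
  obtain ⟨c, hc⟩ := exists_complexMGF_mul hlam
  refine ⟨c, ?_, fun t => ?_⟩
  · funext t
    have h := hc t
    have e : ∀ r : ℝ, Complex.sinhc ((t : ℂ) * r / 2) = (Real.sinhc (r / 2 * t) : ℂ) := by
      intro r
      rw [← Complex.sinhc_ofReal]
      congr 1
      push_cast
      ring
    simp only [e, complexMGF_ofReal] at h
    have h' : mgf (ssytRankRV lam) (ssytUniform lam n) t *
        ∏ x ∈ ltPairs n, Real.sinhc (rowDist x / 2 * t) =
        Real.exp (c * t) * ∏ x ∈ ltPairs n, Real.sinhc (lam.gap x / 2 * t) := by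
      exact_mod_cast h
    have hpos : ∀ f : ℕ × ℕ → ℝ, 0 < ∏ x ∈ ltPairs n, Real.sinhc (f x) :=
      fun f => Finset.prod_pos fun x _ => Real.sinhc_pos _
    have hm : mgf (ssytRankRV lam) (ssytUniform lam n) t ≠ 0 := by
      intro h0
      rw [h0, zero_mul] at h'
      exact (mul_pos (Real.exp_pos _) (hpos _)).ne h'
    have h2 := congrArg Real.log h'
    rw [Real.log_mul hm (hpos _).ne', Real.log_mul (Real.exp_pos _).ne' (hpos _).ne',
      Real.log_exp, Real.log_prod fun x _ => (Real.sinhc_pos _).ne',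
      Real.log_prod fun x _ => (Real.sinhc_pos _).ne'] at h2
    rw [cgf, Finset.sum_sub_distrib]
    simp only [Real.logSinhc]
    linarith
  · have h := hc (t * Complex.I)
    have e : ∀ r : ℝ, Complex.sinhc ((t : ℂ) * Complex.I * r / 2) =
        (Real.sinc (r / 2 * t) : ℂ) := by
      intro r
      rw [← Complex.sinhc_ofReal_mul_I]
      congr 1
      push_cast
      ring
    simpa only [e] using h

/-- The power sum difference whose multiples are the cumulants of the rank. -/
noncomputable def gapPowSum (lam : YoungDiagram) (n d : ℕ) : ℝ :=
  ∑ x ∈ ltPairs n, (lam.gap x ^ d - rowDist x ^ d)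

lemma iteratedDeriv_cgf_aux (lam : YoungDiagram) (n : ℕ) (c : ℝ) {d : ℕ} (hd : 2 ≤ d) :
    iteratedDeriv d (fun t => c * t + ∑ x ∈ ltPairs n,
      (Real.logSinhc (lam.gap x / 2 * t) - Real.logSinhc (rowDist x / 2 * t))) 0 =
    iteratedDeriv d Real.logSinhc 0 / 2 ^ d * gapPowSum lam n d := by
  have hle : (d : WithTop ℕ∞) ≤ ((⊤ : ℕ∞) : WithTop ℕ∞) := by exact_mod_cast le_top
  have hs : ContDiff ℝ d Real.logSinhc := Real.contDiff_logSinhc.of_le hle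
  have hs' : ∀ r : ℝ, ContDiff ℝ d fun t => Real.logSinhc (r * t) := fun r =>
    hs.comp (contDiff_const.mul contDiff_id)
  have hl : ContDiff ℝ d fun t => c * t := contDiff_const.mul contDiff_id
  have h1 : iteratedDeriv d (fun t => c * t) 0 = 0 := by
    rw [iteratedDeriv_const_mul_field, iteratedDeriv_fun_id_zero, if_neg (by omega), mul_zero]
  rw [iteratedDeriv_fun_add hl.contDiffAt
    (ContDiff.sum fun x _ => (hs' _).sub (hs' _)).contDiffAt, h1, zero_add,
    iteratedDeriv_fun_sum fun x _ => ((hs' _).sub (hs' _)).contDiffAt, gapPowSum, Finset.mul_sum]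
  refine Finset.sum_congr rfl fun x _ => ?_
  rw [iteratedDeriv_fun_sub (hs' _).contDiffAt (hs' _).contDiffAt,
    iteratedDeriv_comp_const_mul hs, iteratedDeriv_comp_const_mul hs]
  simp only [mul_zero, div_pow]
  ring

lemma rankCumulant_eq (hlam : lam.colLen 0 ≤ n) {d : ℕ} (hd : 2 ≤ d) :
    rankCumulant lam n d = iteratedDeriv d Real.logSinhc 0 / 2 ^ d * gapPowSum lam n d := by
  obtain ⟨c, hc, -⟩ := exists_cgf_eq hlam
  rw [rankCumulant, cumulant, hc, iteratedDeriv_cgf_aux lam n c hd]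

lemma zero_mem_interior_integrableExpSet :
    0 ∈ interior (integrableExpSet (ssytRankRV lam) (ssytUniform lam n)) := by
  have : integrableExpSet (ssytRankRV lam) (ssytUniform lam n) = Set.univ :=
    Set.eq_univ_of_forall fun t => integrable_ssytUniform _
  simp [this]

/-- The second cumulant; `1 / 12` is `(1 / 3) / 2 ^ 2`. -/
lemma variance_rank (hlam : lam.colLen 0 ≤ n) :
    variance (ssytRankRV lam) (ssytUniform lam n) = gapPowSum lam n 2 / 12 := by
  have hP := isProbabilityMeasure_ssytUniform hlam
  have h := variance_tilted_mul (zero_mem_interior_integrableExpSet (lam := lam) (n := n))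
  simp only [zero_mul] at h
  rw [tilted_const] at h
  have h2 := rankCumulant_eq hlam le_rfl
  rw [rankCumulant, cumulant, ← h, Real.iteratedDeriv_two_logSinhc] at h2
  rw [h2]
  ring

lemma measurable_rank {E : Type*} [MeasurableSpace E] (f : SemistandardYoungTableau lam → E) :
    Measurable f := fun _ _ => trivial

/-- The characteristic function of the standardized rank. -/
lemma charFun_standardize_rank (hlam : lam.colLen 0 ≤ n) (t : ℝ) :
    charFun ((ssytUniform lam n).map (standardize (ssytRankRV lam) (ssytUniform lam n))) t *
      ((∏ x ∈ ltPairs n, Real.sinc (rowDist x / 2 * (t / √(gapPowSum lam n 2 / 12))) : ℝ) : ℂ) =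
    ((∏ x ∈ ltPairs n, Real.sinc (lam.gap x / 2 * (t / √(gapPowSum lam n 2 / 12))) : ℝ) : ℂ) := by
  have hP := isProbabilityMeasure_ssytUniform hlam
  obtain ⟨c, hcgf, hc⟩ := exists_cgf_eq hlam
  -- The derivative of `logSinhc` vanishes at `0`, so the linear coefficient `c` is the mean.
  have hmean : ∫ T, ssytRankRV lam T ∂(ssytUniform lam n) = c := by
    have h := deriv_cgf_zero (zero_mem_interior_integrableExpSet (lam := lam) (n := n))
    rw [probReal_univ, div_one, hcgf] at h
    rw [← h]
    have hd : HasDerivAt Real.logSinhc 0 0 := by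
      have := (Real.contDiff_logSinhc.differentiable (by simp) 0).hasDerivAt
      rwa [Real.deriv_logSinhc_zero] at this
    have hd' : ∀ r : ℝ, HasDerivAt (fun t => Real.logSinhc (r * t)) 0 0 := by
      intro r
      have h1 : HasDerivAt (fun t : ℝ => r * t) (r * 1) 0 := (hasDerivAt_id 0).const_mul r
      have h2 : HasDerivAt Real.logSinhc 0 (r * 0) := by rwa [mul_zero]
      have h3 := h2.comp 0 h1
      rwa [zero_mul] at h3
    have h3 : HasDerivAt (fun t => c * t + ∑ x ∈ ltPairs n,
        (Real.logSinhc (lam.gap x / 2 * t) - Real.logSinhc (rowDist x / 2 * t)))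
        (c * 1 + ∑ x ∈ ltPairs n, (0 - 0)) 0 :=
      ((hasDerivAt_id 0).const_mul c).add
        (HasDerivAt.fun_sum fun x _ => (hd' _).sub (hd' _))
    rw [h3.deriv]
    simp
  set s := √(gapPowSum lam n 2 / 12) with hs
  have h1 : charFun ((ssytUniform lam n).map
      (standardize (ssytRankRV lam) (ssytUniform lam n))) t =
      Complex.exp (-(c * ((t / s : ℝ) * Complex.I))) *
        complexMGF (ssytRankRV lam) (ssytUniform lam n) ((t / s : ℝ) * Complex.I) := by
    rw [charFun_apply_real, integral_map (measurable_rank _).aemeasurable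
      (by fun_prop), complexMGF, ← integral_const_mul]
    refine integral_congr_ae (Eventually.of_forall fun T => ?_)
    simp only [standardize, hmean, variance_rank hlam, ← hs]
    rw [← Complex.exp_add]
    congr 1
    push_cast
    ring
  rw [h1]
  push_cast
  have h2 := hc (t / s)
  push_cast at h2
  rw [mul_assoc, h2, ← mul_assoc, ← Complex.exp_add]
  simp

end SemistandardYoungTableau

/-! ### Comparison of power sums with sums over blocks of equal rows -/

lemma pow_succ_sub_pow_succ_le {x y : ℝ} (hy : 0 ≤ y) (hyx : y ≤ x) (p : ℕ) :
    x ^ (p + 1) - y ^ (p + 1) ≤ (p + 1) * (x - y) * x ^ p := by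
  induction p with
  | zero => simp
  | succ p ih =>
    have hx : 0 ≤ x := hy.trans hyx
    have h1 : y ^ (p + 1) ≤ x ^ (p + 1) := pow_le_pow_left₀ hy hyx _
    have h2 := mul_le_mul_of_nonneg_right ih hx
    have h3 := mul_le_mul_of_nonneg_left h1 (sub_nonneg.mpr hyx)
    push_cast
    calc x ^ (p + 1 + 1) - y ^ (p + 1 + 1)
        = (x ^ (p + 1) - y ^ (p + 1)) * x + (x - y) * y ^ (p + 1) := by ring
      _ ≤ (p + 1) * (x - y) * x ^ p * x + (x - y) * x ^ (p + 1) := add_le_add h2 h3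
      _ = _ := by ring

lemma mul_pow_le_pow_succ_sub {x y : ℝ} (hy : 0 ≤ y) (hyx : y ≤ x) (p : ℕ) :
    (x - y) * x ^ p ≤ x ^ (p + 1) - y ^ (p + 1) := by
  have h := mul_le_mul_of_nonneg_left (pow_le_pow_left₀ hy hyx p) hy
  rw [pow_succ, pow_succ]
  linarith

/-- Over a rectangle, the `p`-th powers of `s - u - v` average to at least a constant times the
`p`-th power of the largest value. -/
lemma rectangle_sum_pow_ge {s : ℝ} (a b p : ℕ) (f : ℕ → ℕ → ℝ)
    (hf : ∀ u < a, ∀ v < b, 0 ≤ f u v)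
    (hs : ∀ u < a, ∀ v < b, s ≤ f u v + f (a - 1 - u) (b - 1 - v)) (hs0 : 0 ≤ s) :
    (1 / 2) ^ (p + 1) * (a * b * s ^ p) ≤
      ∑ u ∈ Finset.range a, ∑ v ∈ Finset.range b, f u v ^ p := by
  have hrefl : ∑ u ∈ Finset.range a, ∑ v ∈ Finset.range b, f (a - 1 - u) (b - 1 - v) ^ p =
      ∑ u ∈ Finset.range a, ∑ v ∈ Finset.range b, f u v ^ p := by
    rw [Finset.sum_range_reflect (fun u => ∑ v ∈ Finset.range b, f u (b - 1 - v) ^ p) a]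
    exact Finset.sum_congr rfl fun u _ => Finset.sum_range_reflect (fun v => f u v ^ p) b
  -- Of a point and its reflection, one has value at least `s / 2`. Summing counts every point
  -- twice, whence the extra factor `1 / 2`.
  have hpt : ∀ u ∈ Finset.range a, ∀ v ∈ Finset.range b,
      (s / 2) ^ p ≤ f u v ^ p + f (a - 1 - u) (b - 1 - v) ^ p := by
    intro u hu v hv
    rw [Finset.mem_range] at hu hv
    have h1 := hf u hu v hv
    have h2 := hf (a - 1 - u) (by omega) (b - 1 - v) (by omega)
    have h3 := hs u hu v hv
    rcases le_total (s / 2) (f u v) with h | h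
    · have := pow_le_pow_left₀ (by positivity) h p
      have := pow_nonneg h2 p
      linarith
    · have := pow_le_pow_left₀ (n := p) (by positivity)
        (show s / 2 ≤ f (a - 1 - u) (b - 1 - v) by linarith)
      have := pow_nonneg h1 p
      linarith
  have hsum := Finset.sum_le_sum fun u hu => Finset.sum_le_sum fun v hv => hpt u hu v hv
  simp only [Finset.sum_add_distrib, Finset.sum_const, Finset.card_range, nsmul_eq_mul] at hsum
  rw [hrefl] at hsum
  have : (1 / 2 : ℝ) ^ (p + 1) * (a * b * s ^ p) = (1 / 2) * (a * (b * (s / 2) ^ p)) := by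
    rw [div_pow s, pow_succ, one_div_pow]
    ring
  rw [this]
  linarith

/-! ### Rows grouped into blocks of equal length -/

namespace IsExponentialNotation

variable {lam : YoungDiagram} {m k : ℕ} {ℓ e : ℕ → ℕ}

/-- The number of rows in the first `a` blocks. -/
def rowsUpTo (e : ℕ → ℕ) (a : ℕ) : ℕ := ∑ c ∈ Finset.Icc 1 a, e c

lemma rowsUpTo_succ (e : ℕ → ℕ) (a : ℕ) : rowsUpTo e (a + 1) = rowsUpTo e a + e (a + 1) :=
  Finset.sum_Icc_succ_top (by omega) _

lemma rowsUpTo_mono (e : ℕ → ℕ) : Monotone (rowsUpTo e) :=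
  monotone_nat_of_le_succ fun a => by rw [rowsUpTo_succ]; omega

lemma sum_range_rowsUpTo {M : Type*} [AddCommMonoid M] (e : ℕ → ℕ) (f : ℕ → M) (k : ℕ) :
    ∑ i ∈ Finset.range (rowsUpTo e k), f i =
      ∑ a ∈ Finset.Icc 1 k, ∑ u ∈ Finset.range (e a), f (rowsUpTo e (a - 1) + u) := by
  induction k with
  | zero => simp [rowsUpTo]
  | succ k ih =>
    rw [rowsUpTo_succ, Finset.sum_range_add, ih, Finset.sum_Icc_succ_top (by omega)]
    rfl

lemma sum_Icc_cast (e : ℕ → ℕ) {a b : ℕ} (ha : 1 ≤ a) (hab : a ≤ b) :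
    ∑ c ∈ Finset.Icc a b, (e c : ℝ) = rowsUpTo e b - rowsUpTo e (a - 1) := by
  induction b, hab using Nat.le_induction with
  | base =>
    obtain ⟨a, rfl⟩ : ∃ a', a = a' + 1 := ⟨a - 1, by omega⟩
    simp [rowsUpTo_succ]
  | succ b hab ih =>
    rw [Finset.sum_Icc_succ_top (by omega), ih, rowsUpTo_succ]
    push_cast
    ring

lemma rowsUpTo_eq (h : IsExponentialNotation lam m k ℓ e) : rowsUpTo e k = m := by
  have := congrArg Multiset.card h.rows
  simpa [rowsUpTo] using this.symm

/-- Row lengths decrease, so the rows satisfying an upward closed condition form an initial segment,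
determined by its size. -/
lemma lt_countP_iff (lam : YoungDiagram) {m i : ℕ} (hi : i < m) (q : ℕ → Prop) [DecidablePred q]
    (hq : Monotone q) :
    q (lam.rowLen i) ↔ i < ((Multiset.range m).map lam.rowLen).countP q := by
  have hcount : ((Multiset.range m).map lam.rowLen).countP q =
      ((Finset.range m).filter fun i => q (lam.rowLen i)).card := by
    rw [Multiset.countP_map]
    rfl
  rw [hcount]
  constructor
  · intro h
    have hsub : Finset.range (i + 1) ⊆ (Finset.range m).filter fun i => q (lam.rowLen i) := by
      intro j hj
      rw [Finset.mem_range] at hj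
      rw [Finset.mem_filter, Finset.mem_range]
      exact ⟨by omega, hq (lam.rowLen_anti j i (by omega)) h⟩
    simpa using Finset.card_le_card hsub
  · intro h
    by_contra hn
    have hsub : ((Finset.range m).filter fun i => q (lam.rowLen i)) ⊆ Finset.range i := by
      intro j hj
      rw [Finset.mem_filter] at hj
      rw [Finset.mem_range]
      by_contra! hji
      exact hn (hq (lam.rowLen_anti i j hji) hj.2)
    have := Finset.card_le_card hsub
    rw [Finset.card_range] at this
    omega

lemma countP_rows (h : IsExponentialNotation lam m k ℓ e) (q : ℕ → Prop) [DecidablePred q] (a : ℕ)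
    (ha : a ≤ k) (hq : ∀ c ∈ Finset.Icc 1 k, q (ℓ c) ↔ c ≤ a) :
    ((Multiset.range m).map lam.rowLen).countP q = rowsUpTo e a := by
  rw [h.rows, ← Multiset.coe_countPAddMonoidHom, map_sum]
  have hrep : ∀ c ∈ Finset.Icc 1 k,
      Multiset.countPAddMonoidHom q (Multiset.replicate (e c) (ℓ c)) =
        if c ≤ a then e c else 0 := by
    intro c hc
    rw [Multiset.coe_countPAddMonoidHom, ← Multiset.coe_replicate, Multiset.coe_countP,
      List.countP_replicate]
    simp [hq c hc]
  rw [Finset.sum_congr rfl hrep, ← Finset.sum_filter, rowsUpTo]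
  refine Finset.sum_congr ?_ fun _ _ => rfl
  ext c
  simp only [Finset.mem_filter, Finset.mem_Icc]
  omega

/-- The notation only gives the multiset of row lengths. Counting the rows of length at least `ℓ a`,
and those of length greater than `ℓ a`, locates the block. -/
lemma rowLen_eq (h : IsExponentialNotation lam m k ℓ e) {a u : ℕ} (ha : a ∈ Finset.Icc 1 k)
    (hu : u < e a) : lam.rowLen (rowsUpTo e (a - 1) + u) = ℓ a := by
  have ha' := Finset.mem_Icc.mp ha
  have hE : rowsUpTo e a = rowsUpTo e (a - 1) + e a := by
    obtain ⟨a, rfl⟩ : ∃ a', a = a' + 1 := ⟨a - 1, by omega⟩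
    exact rowsUpTo_succ e a
  have hm := h.rowsUpTo_eq
  have hmono := rowsUpTo_mono e ha'.2
  have hlt : rowsUpTo e (a - 1) + u < m := by omega
  have h1 := lt_countP_iff lam hlt (fun x => ℓ a ≤ x) (fun x y hxy hx => le_trans hx hxy)
  have h2 := lt_countP_iff lam hlt (fun x => ℓ a < x) (fun x y hxy hx => lt_of_lt_of_le hx hxy)
  rw [h.countP_rows _ a ha'.2] at h1
  · rw [h.countP_rows _ (a - 1) (by omega)] at h2
    · apply le_antisymm
      · by_contra! hlt'
        have := h2.mp hlt'
        omega
      · exact h1.mpr (by omega)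
    · intro c hc
      rw [h.strictAnti.lt_iff_gt (Finset.mem_Icc.mp ha) (Finset.mem_Icc.mp hc)]
      omega
  · intro c hc
    exact h.strictAnti.le_iff_ge (Finset.mem_Icc.mp ha) (Finset.mem_Icc.mp hc)

open SemistandardYoungTableau YoungDiagram

lemma rowsUpTo_pred (e : ℕ → ℕ) {a : ℕ} (ha : 1 ≤ a) :
    rowsUpTo e a = rowsUpTo e (a - 1) + e a := by
  obtain ⟨a, rfl⟩ : ∃ a', a = a' + 1 := ⟨a - 1, by omega⟩
  exact rowsUpTo_succ e a

/-- Pairs inside one block contribute nothing, and across blocks the order of rows is the order of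
blocks. -/
lemma sum_ltPairs (h : IsExponentialNotation lam m k ℓ e) (f : ℕ × ℕ → ℝ)
    (hf : ∀ x, lam.rowLen x.1 = lam.rowLen x.2 → f x = 0) :
    ∑ x ∈ ltPairs m, f x = ∑ a ∈ Finset.Icc 1 k, ∑ b ∈ Finset.Ioc a k,
      ∑ u ∈ Finset.range (e a), ∑ v ∈ Finset.range (e b),
        f (rowsUpTo e (a - 1) + u, rowsUpTo e (b - 1) + v) := by
  rw [ltPairs, Finset.sum_filter, Finset.sum_product, ← h.rowsUpTo_eq,
    sum_range_rowsUpTo e (fun i => ∑ j ∈ Finset.range (rowsUpTo e k), _)]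
  refine Finset.sum_congr rfl fun a ha => ?_
  have ha' := Finset.mem_Icc.mp ha
  have hsub : Finset.Ioc a k ⊆ Finset.Icc 1 k := fun b hb => by
    rw [Finset.mem_Ioc] at hb
    rw [Finset.mem_Icc]
    omega
  rw [Finset.sum_comm (s := Finset.Ioc a k)]
  refine Finset.sum_congr rfl fun u hu => ?_
  rw [Finset.mem_range] at hu
  rw [sum_range_rowsUpTo e]
  rw [← Finset.sum_subset hsub]
  · refine Finset.sum_congr rfl fun b hb => Finset.sum_congr rfl fun v _ => ?_
    rw [Finset.mem_Ioc] at hb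
    have h1 := rowsUpTo_pred e ha'.1
    have h2 := rowsUpTo_mono e (show a ≤ b - 1 by omega)
    rw [if_pos]
    change rowsUpTo e (a - 1) + u < rowsUpTo e (b - 1) + v
    omega
  · intro b hb hb'
    have hb1 := Finset.mem_Icc.mp hb
    refine Finset.sum_eq_zero fun v hv => ?_
    rw [Finset.mem_range] at hv
    rw [Finset.mem_Ioc] at hb'
    rcases eq_or_ne a b with rfl | hne
    · rw [hf _ (by rw [h.rowLen_eq ha hu, h.rowLen_eq ha hv]), ite_self]
    · have h1 := rowsUpTo_pred e hb1.1
      have h2 := rowsUpTo_mono e (show b ≤ a - 1 by omega)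
      rw [if_neg]
      change ¬ rowsUpTo e (a - 1) + u < rowsUpTo e (b - 1) + v
      omega

/-- The power sum of the gaps is comparable to the sum over pairs of blocks. -/
lemma gapPowSum_bounds (h : IsExponentialNotation lam m k ℓ e) (p : ℕ) :
    (1 / 2) ^ (p + 1) * pairSum k ℓ e p ≤ gapPowSum lam m (p + 1) ∧
      gapPowSum lam m (p + 1) ≤ (p + 1) * pairSum k ℓ e p := by
  rw [gapPowSum, h.sum_ltPairs _ (fun x hx => by simp [gap, rowDist, hx]), pairSum,
    Finset.mul_sum, Finset.mul_sum]
  have key : ∀ a ∈ Finset.Icc 1 k, ∀ b ∈ Finset.Ioc a k,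
      (1 / 2) ^ (p + 1) * (((ℓ a : ℝ) - ℓ b) * e a * e b *
        ((ℓ a : ℝ) - ℓ b - 1 + ∑ c ∈ Finset.Icc a b, (e c : ℝ)) ^ p) ≤
      ∑ u ∈ Finset.range (e a), ∑ v ∈ Finset.range (e b),
        (lam.gap (rowsUpTo e (a - 1) + u, rowsUpTo e (b - 1) + v) ^ (p + 1) -
          rowDist (rowsUpTo e (a - 1) + u, rowsUpTo e (b - 1) + v) ^ (p + 1)) ∧
      ∑ u ∈ Finset.range (e a), ∑ v ∈ Finset.range (e b),
        (lam.gap (rowsUpTo e (a - 1) + u, rowsUpTo e (b - 1) + v) ^ (p + 1) -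
          rowDist (rowsUpTo e (a - 1) + u, rowsUpTo e (b - 1) + v) ^ (p + 1)) ≤
      (p + 1) * (((ℓ a : ℝ) - ℓ b) * e a * e b *
        ((ℓ a : ℝ) - ℓ b - 1 + ∑ c ∈ Finset.Icc a b, (e c : ℝ)) ^ p) := by
    intro a ha b hb
    have ha' := Finset.mem_Icc.mp ha
    have hb' := Finset.mem_Ioc.mp hb
    have hb1 : b ∈ Finset.Icc 1 k := Finset.mem_Icc.mpr ⟨by omega, hb'.2⟩
    have hEa : (rowsUpTo e a : ℝ) = rowsUpTo e (a - 1) + e a := by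
      exact_mod_cast rowsUpTo_pred e ha'.1
    have hEb : (rowsUpTo e b : ℝ) = rowsUpTo e (b - 1) + e b := by
      exact_mod_cast rowsUpTo_pred e (show 1 ≤ b by omega)
    have hEab : (rowsUpTo e a : ℝ) ≤ rowsUpTo e (b - 1) := by
      exact_mod_cast rowsUpTo_mono e (show a ≤ b - 1 by omega)
    have hl : ℓ b + 1 ≤ ℓ a := h.strictAnti (Finset.mem_Icc.mp ha) (Finset.mem_Icc.mp hb1) hb'.1
    have hl : (ℓ b : ℝ) + 1 ≤ ℓ a := by exact_mod_cast hl
    rw [sum_Icc_cast e ha'.1 hb'.1.le]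
    -- The largest gap between the two blocks: first row of block `a` against last row of block `b`.
    set S : ℝ := (ℓ a : ℝ) - ℓ b - 1 + (rowsUpTo e b - rowsUpTo e (a - 1)) with hS
    have hgap : ∀ u < e a, ∀ v < e b,
        lam.gap (rowsUpTo e (a - 1) + u, rowsUpTo e (b - 1) + v) =
          (ℓ a : ℝ) - ℓ b + ((rowsUpTo e (b - 1) + v) - (rowsUpTo e (a - 1) + u)) := by
      intro u hu v hv
      rw [gap, h.rowLen_eq ha hu, h.rowLen_eq hb1 hv]
      push_cast
      ring
    have hdist : ∀ u v : ℕ, rowDist (rowsUpTo e (a - 1) + u, rowsUpTo e (b - 1) + v) =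
          ((rowsUpTo e (b - 1) : ℝ) + v) - (rowsUpTo e (a - 1) + u) := by
      intro u v
      rw [rowDist]
      push_cast
      ring
    have hu1 : ∀ u < e a, (u : ℝ) + 1 ≤ e a := fun u hu => by exact_mod_cast hu
    have hv1 : ∀ v < e b, (v : ℝ) + 1 ≤ e b := fun v hv => by exact_mod_cast hv
    have hsub : ∀ u < e a, ((e a - 1 - u : ℕ) : ℝ) = e a - 1 - u := fun u hu => by
      rw [Nat.cast_sub (by omega), Nat.cast_sub (by omega), Nat.cast_one]
    have hsub' : ∀ v < e b, ((e b - 1 - v : ℕ) : ℝ) = e b - 1 - v := fun v hv => by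
      rw [Nat.cast_sub (by omega), Nat.cast_sub (by omega), Nat.cast_one]
    have hd0 : ∀ u < e a, ∀ v < e b,
        0 ≤ rowDist (rowsUpTo e (a - 1) + u, rowsUpTo e (b - 1) + v) := by
      intro u hu v hv
      have := hu1 u hu
      have hv0 : (0 : ℝ) ≤ v := Nat.cast_nonneg v
      rw [hdist]
      linarith
    have hdg : ∀ u < e a, ∀ v < e b,
        lam.gap (rowsUpTo e (a - 1) + u, rowsUpTo e (b - 1) + v) -
          rowDist (rowsUpTo e (a - 1) + u, rowsUpTo e (b - 1) + v) = (ℓ a : ℝ) - ℓ b := by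
      intro u hu v hv
      rw [hgap u hu v hv, hdist]
      ring
    have hS0 : 0 ≤ S := by
      have : (0 : ℝ) ≤ e a := Nat.cast_nonneg _
      have : (0 : ℝ) ≤ e b := Nat.cast_nonneg _
      linarith
    constructor
    -- A gap and its reflection add up to `S` plus `ℓ a - ℓ b + 1` plus the number of rows strictly
    -- between the blocks.
    · have hrect := rectangle_sum_pow_ge (e a) (e b) p
        (fun u v => lam.gap (rowsUpTo e (a - 1) + u, rowsUpTo e (b - 1) + v))
        (fun u hu v hv => by
          have h1 := hd0 u hu v hv
          have h2 := hdg u hu v hv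
          linarith)
        (s := S) (fun u hu v hv => by
          rw [hgap u hu v hv, hgap _ (by omega) _ (by omega), hsub u hu, hsub' v hv]
          linarith) hS0
      calc (1 / 2) ^ (p + 1) * (((ℓ a : ℝ) - ℓ b) * e a * e b * S ^ p)
          = ((ℓ a : ℝ) - ℓ b) * ((1 / 2) ^ (p + 1) * (e a * e b * S ^ p)) := by ring
        _ ≤ ((ℓ a : ℝ) - ℓ b) * _ := mul_le_mul_of_nonneg_left hrect (by linarith)
        _ = ∑ u ∈ Finset.range (e a), ∑ v ∈ Finset.range (e b), ((ℓ a : ℝ) - ℓ b) *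
            lam.gap (rowsUpTo e (a - 1) + u, rowsUpTo e (b - 1) + v) ^ p := by
          simp only [Finset.mul_sum]
        _ ≤ _ := by
          refine Finset.sum_le_sum fun u hu => Finset.sum_le_sum fun v hv => ?_
          rw [Finset.mem_range] at hu hv
          have h1 := hd0 u hu v hv
          have h2 := hdg u hu v hv
          rw [← h2]
          exact mul_pow_le_pow_succ_sub h1 (by linarith) p
    · calc _ ≤ ∑ u ∈ Finset.range (e a), ∑ v ∈ Finset.range (e b),
            (p + 1) * ((ℓ a : ℝ) - ℓ b) * S ^ p := by
            refine Finset.sum_le_sum fun u hu => Finset.sum_le_sum fun v hv => ?_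
            rw [Finset.mem_range] at hu hv
            have h1 := hd0 u hu v hv
            have h2 := hdg u hu v hv
            have h3 := hv1 v hv
            have h4 : (0 : ℝ) ≤ u := Nat.cast_nonneg u
            refine (pow_succ_sub_pow_succ_le h1 (by linarith) p).trans ?_
            rw [h2]
            refine mul_le_mul_of_nonneg_left
              (pow_le_pow_left₀ (by linarith) ?_ p)
              (mul_nonneg (by positivity) (by linarith))
            rw [hgap u hu v hv]
            linarith
        _ = _ := by
          simp only [Finset.sum_const, Finset.card_range, nsmul_eq_mul]
          ring
  constructor
  · refine Finset.sum_le_sum fun a ha => ?_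
    rw [Finset.mul_sum]
    exact Finset.sum_le_sum fun b hb => (key a ha b hb).1
  · refine Finset.sum_le_sum fun a ha => ?_
    rw [Finset.mul_sum]
    exact Finset.sum_le_sum fun b hb => (key a ha b hb).2

/-- The extreme pair consists of the first and the last of the `m` rows. -/
lemma gap_le (h : IsExponentialNotation lam m k ℓ e) {x : ℕ × ℕ} (hx : x ∈ ltPairs m) :
    lam.gap x ≤ (ℓ 1 : ℝ) - ℓ k - 1 + m := by
  have hk := h.one_le
  have h1 : lam.rowLen 0 = ℓ 1 := by
    have h1 : 1 ∈ Finset.Icc 1 k := Finset.mem_Icc.mpr ⟨le_rfl, hk⟩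
    simpa [rowsUpTo] using h.rowLen_eq h1 (h.pos 1 h1)
  have hkk : k ∈ Finset.Icc 1 k := Finset.mem_Icc.mpr ⟨hk, le_rfl⟩
  have hpos := h.pos k hkk
  have h2 := h.rowLen_eq hkk (u := e k - 1) (by omega)
  have h3 := rowsUpTo_pred e hk
  rw [h.rowsUpTo_eq] at h3
  have hx' := mem_ltPairs.mp hx
  have h4 := lam.rowLen_anti 0 x.1 (Nat.zero_le _)
  have h5 := lam.rowLen_anti x.2 (rowsUpTo e (k - 1) + (e k - 1)) (by omega)
  rw [h1] at h4
  rw [h2] at h5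
  have h4 : (lam.rowLen x.1 : ℝ) ≤ ℓ 1 := by exact_mod_cast h4
  have h5 : (ℓ k : ℝ) ≤ lam.rowLen x.2 := by exact_mod_cast h5
  have h6 : x.2 + 1 ≤ m := hx'.2
  have h6 : (x.2 : ℝ) + 1 ≤ m := by exact_mod_cast h6
  have h7 : (0 : ℝ) ≤ x.1 := Nat.cast_nonneg _
  rw [gap]
  linarith

end IsExponentialNotation

/-! ### Asymptotic normality -/

namespace Real

lemma nonneg_of_hasDerivAt_nonneg {f f' : ℝ → ℝ} (h0 : f 0 = 0)
    (hf : ∀ x, HasDerivAt f (f' x) x) (hf' : ∀ x, 0 ≤ x → x ≤ 1 → 0 ≤ f' x) {x : ℝ}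
    (hx : 0 ≤ x) (hx1 : x ≤ 1) : 0 ≤ f x := by
  have hmono : MonotoneOn f (Set.Icc 0 1) := by
    refine monotoneOn_of_deriv_nonneg (convex_Icc 0 1)
      (fun x _ => (hf x).continuousAt.continuousWithinAt)
      (fun x _ => (hf x).differentiableAt.differentiableWithinAt) fun x hx => ?_
    rw [interior_Icc] at hx
    rw [(hf x).deriv]
    exact hf' x hx.1.le hx.2.le
  rw [← h0]
  exact hmono ⟨le_rfl, zero_le_one⟩ ⟨hx, hx1⟩ hx

lemma sin_nonneg_of_le_one {x : ℝ} (hx : 0 ≤ x) (hx1 : x ≤ 1) : 0 ≤ sin x :=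
  sin_nonneg_of_nonneg_of_le_pi hx (by linarith [pi_gt_three])

lemma sin_sub_mul_cos_bounds {x : ℝ} (hx : 0 ≤ x) (hx1 : x ≤ 1) :
    0 ≤ sin x - x * cos x ∧ sin x - x * cos x ≤ x ^ 3 / 3 := by
  have hd : ∀ x, HasDerivAt (fun x => sin x - x * cos x) (x * sin x) x := by
    intro x
    have h := (hasDerivAt_sin x).sub ((hasDerivAt_id x).mul (hasDerivAt_cos x))
    convert! h using 1
    simp
  constructor
  · refine nonneg_of_hasDerivAt_nonneg (by simp) hd ?_ hx hx1
    intro x hx hx1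
    exact mul_nonneg hx (sin_nonneg_of_le_one hx hx1)
  · have hd' : ∀ x, HasDerivAt (fun x => x ^ 3 / 3 - (sin x - x * cos x))
        (x ^ 2 - x * sin x) x := by
      intro x
      have h := ((hasDerivAt_pow 3 x).div_const 3).sub (hd x)
      convert! h using 1
      norm_num
    have := nonneg_of_hasDerivAt_nonneg (by simp) hd' (fun x hx _ => by
      have := mul_le_mul_of_nonneg_left (sin_le hx) hx
      nlinarith) hx hx1
    linarith

/-- The derivative is `x (sin x - x cos x)`, so the previous bounds integrate. Up to sign and a
positive denominator, this expression is the derivative of `log (sinc x) + x ^ 2 / 6`. -/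
lemma three_mul_sin_sub_bounds {x : ℝ} (hx : 0 ≤ x) (hx1 : x ≤ 1) :
    0 ≤ 3 * sin x - 3 * x * cos x - x ^ 2 * sin x ∧
      3 * sin x - 3 * x * cos x - x ^ 2 * sin x ≤ x ^ 5 / 15 := by
  have hd : ∀ x, HasDerivAt (fun x => 3 * sin x - 3 * x * cos x - x ^ 2 * sin x)
      (x * (sin x - x * cos x)) x := by
    intro x
    have h := (((hasDerivAt_sin x).const_mul 3).sub
      (((hasDerivAt_id x).const_mul 3).mul (hasDerivAt_cos x))).sub
        ((hasDerivAt_pow 2 x).mul (hasDerivAt_sin x))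
    convert! h using 1
    simp
    ring
  constructor
  · refine nonneg_of_hasDerivAt_nonneg (by simp) hd ?_ hx hx1
    intro x hx hx1
    exact mul_nonneg hx (sin_sub_mul_cos_bounds hx hx1).1
  · have hd' : ∀ x, HasDerivAt (fun x => x ^ 5 / 15 -
        (3 * sin x - 3 * x * cos x - x ^ 2 * sin x)) (x ^ 4 / 3 - x * (sin x - x * cos x)) x := by
      intro x
      have h := ((hasDerivAt_pow 5 x).div_const 15).sub (hd x)
      convert! h using 1
      norm_num
      ring
    have := nonneg_of_hasDerivAt_nonneg (by simp) hd' (fun x hx hx1 => by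
      have := mul_le_mul_of_nonneg_left (sin_sub_mul_cos_bounds hx hx1).2 hx
      nlinarith) hx hx1
    linarith

lemma sinc_pos_of_le_one {x : ℝ} (hx : 0 < x) (hx1 : x ≤ 1) : 0 < sinc x := by
  rw [sinc_of_ne_zero hx.ne']
  exact div_pos (sin_pos_of_pos_of_lt_pi hx (by linarith [pi_gt_three])) hx

/-- A fourth order estimate for `log (sin x / x) + x ^ 2 / 6`. -/
lemma log_sinc_sub_bounds {x y : ℝ} (hy : 0 < y) (hyx : y ≤ x) (hx1 : x ≤ 1) :
    |(log (sinc x) - log (sinc y)) + (x ^ 2 - y ^ 2) / 6| ≤ (x ^ 4 - y ^ 4) / 90 := by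
  -- `F` decreases and `F + x ^ 4 / 90` increases on `(0, 1]`; these give the two sides of the
  -- estimate.
  let F : ℝ → ℝ := fun x => log (sin x) - log x + x ^ 2 / 6
  have hs : ∀ x ∈ Set.Ioc (0 : ℝ) 1, 0 < sin x := fun x hx =>
    sin_pos_of_pos_of_lt_pi hx.1 (by linarith [pi_gt_three, hx.2])
  have hF : ∀ x ∈ Set.Ioc (0 : ℝ) 1, HasDerivAt F
      (-((3 * sin x - 3 * x * cos x - x ^ 2 * sin x) / (3 * x * sin x))) x := by
    intro x hx
    have h := (((hasDerivAt_sin x).log (hs x hx).ne').sub (hasDerivAt_log hx.1.ne')).add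
      ((hasDerivAt_pow 2 x).div_const 6)
    convert! h using 1
    have h1 := (hs x hx).ne'
    have h2 := hx.1.ne'
    field_simp
    push_cast
    ring
  have hFs : ∀ x ∈ Set.Ioc (0 : ℝ) 1, F x = log (sinc x) + x ^ 2 / 6 := by
    intro x hx
    rw [sinc_of_ne_zero hx.1.ne', log_div (hs x hx).ne' hx.1.ne']
  have hanti : AntitoneOn F (Set.Ioc 0 1) := by
    refine antitoneOn_of_deriv_nonpos (convex_Ioc 0 1)
      (fun x hx => (hF x hx).continuousAt.continuousWithinAt)
      (fun x hx => (hF x (interior_subset hx)).differentiableAt.differentiableWithinAt)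
      fun x hx => ?_
    have hx := interior_subset hx
    rw [(hF x hx).deriv, neg_nonpos]
    have := hx.1
    have := hs x hx
    exact div_nonneg (three_mul_sin_sub_bounds hx.1.le hx.2).1 (by positivity)
  have hG : ∀ x ∈ Set.Ioc (0 : ℝ) 1, HasDerivAt (fun x => F x + x ^ 4 / 90)
      (-((3 * sin x - 3 * x * cos x - x ^ 2 * sin x) / (3 * x * sin x)) + 2 * x ^ 3 / 45) x := by
    intro x hx
    have h := (hF x hx).add ((hasDerivAt_pow 4 x).div_const 90)
    convert! h using 1
    push_cast
    ring
  have hmono : MonotoneOn (fun x => F x + x ^ 4 / 90) (Set.Ioc 0 1) := by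
    refine monotoneOn_of_deriv_nonneg (convex_Ioc 0 1)
      (fun x hx => (hG x hx).continuousAt.continuousWithinAt)
      (fun x hx => (hG x (interior_subset hx)).differentiableAt.differentiableWithinAt)
      fun x hx => ?_
    have hx := interior_subset hx
    have h0 := hx.1
    have h1 := hs x hx
    rw [(hG x hx).deriv, neg_add_eq_sub, sub_nonneg, div_le_iff₀ (by positivity)]
    have h2 : x / 2 ≤ sin x := by
      have h3 := sin_gt_sub_cube h0
      have h4 : x ^ 2 ≤ 1 := pow_le_one₀ h0.le hx.2
      have h5 := mul_le_mul_of_nonneg_left h4 h0.le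
      nlinarith
    calc _ ≤ x ^ 5 / 15 := (three_mul_sin_sub_bounds h0.le hx.2).2
      _ = 2 * x ^ 3 / 45 * (3 * x * (x / 2)) := by ring
      _ ≤ _ := by gcongr
  have hxm : x ∈ Set.Ioc (0 : ℝ) 1 := ⟨hy.trans_le hyx, hx1⟩
  have hym : y ∈ Set.Ioc (0 : ℝ) 1 := ⟨hy, hyx.trans hx1⟩
  have h1 := hanti hym hxm hyx
  have h2 := hmono hym hxm hyx
  simp only at h2
  rw [hFs x hxm, hFs y hym] at h1 h2
  have h3 := pow_le_pow_left₀ hy.le hyx 4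
  rw [abs_le]
  constructor <;> linarith

end Real

/-! ### Gaussian approximation of the characteristic function -/

namespace SemistandardYoungTableau

open YoungDiagram

variable {lam : YoungDiagram} {n : ℕ}

lemma gapPowSum_four_le {D : ℝ} (hD : ∀ x ∈ ltPairs n, lam.gap x ≤ D) :
    gapPowSum lam n 4 ≤ 2 * D ^ 2 * gapPowSum lam n 2 := by
  rw [gapPowSum, gapPowSum, Finset.mul_sum]
  refine Finset.sum_le_sum fun x hx => ?_
  have h1 := one_le_rowDist hx
  have h2 := rowDist_le_gap lam hx
  have h3 := pow_le_pow_left₀ (by linarith) (hD x hx) 2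
  have h4 := pow_le_pow_left₀ (by linarith) h2 2
  calc lam.gap x ^ 4 - rowDist x ^ 4
      = (lam.gap x ^ 2 + rowDist x ^ 2) * (lam.gap x ^ 2 - rowDist x ^ 2) := by ring
    _ ≤ (2 * D ^ 2) * (lam.gap x ^ 2 - rowDist x ^ 2) :=
        mul_le_mul_of_nonneg_right (by linarith) (by linarith)

/-- A quantitative Gaussian approximation of the characteristic function of the standardized
rank. -/
lemma charFun_standardize_rank_approx (hlam : lam.colLen 0 ≤ n) {D t : ℝ}
    (hD : ∀ x ∈ ltPairs n, lam.gap x ≤ D) (ht : t ≠ 0) (hv : 0 < gapPowSum lam n 2)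
    (hDt : D ^ 2 / gapPowSum lam n 2 * t ^ 2 ≤ 1 / 3) :
    ∃ r : ℝ, charFun ((ssytUniform lam n).map
        (standardize (ssytRankRV lam) (ssytUniform lam n))) t = (Real.exp r : ℂ) ∧
      |r + t ^ 2 / 2| ≤ t ^ 4 * (D ^ 2 / gapPowSum lam n 2) := by
  set V := gapPowSum lam n 2 with hV
  set θ := t / √(V / 12) with hθ
  have hsq : θ ^ 2 = 12 * t ^ 2 / V := by
    rw [hθ, div_pow, Real.sq_sqrt (by positivity)]
    field_simp
  -- The logarithmic estimate needs positive arguments; as `sinc` is even, `θ` may be replaced by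
  -- `|θ|`.
  have hθ0 : 0 < |θ| := abs_pos.mpr (div_ne_zero ht (Real.sqrt_pos.mpr (by positivity)).ne')
  have hsinc : ∀ r : ℝ, Real.sinc (r / 2 * θ) = Real.sinc (r / 2 * |θ|) := by
    intro r
    rcases abs_choice θ with h | h
    · rw [h]
    · rw [h, mul_neg, Real.sinc_neg]
  have hbd : ∀ x ∈ ltPairs n, 0 < rowDist x / 2 * |θ| ∧
      rowDist x / 2 * |θ| ≤ lam.gap x / 2 * |θ| ∧ lam.gap x / 2 * |θ| ≤ 1 := by
    intro x hx
    have h1 := one_le_rowDist hx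
    have h2 := rowDist_le_gap lam hx
    have h3 := hD x hx
    refine ⟨by positivity, by gcongr, ?_⟩
    -- The bound `1 / 3` in `hDt` is what keeps all arguments of `sinc` in `(0, 1]`.
    have h4 : (D / 2 * |θ|) ^ 2 ≤ 1 ^ 2 := by
      rw [mul_pow, sq_abs, hsq]
      calc (D / 2) ^ 2 * (12 * t ^ 2 / V) = 3 * (D ^ 2 / V * t ^ 2) := by ring
        _ ≤ 1 ^ 2 := by linarith
    have h5 : D / 2 * |θ| ≤ 1 := (abs_le_of_sq_le_sq' h4 zero_le_one).2
    refine le_trans ?_ h5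
    gcongr
  have hpos1 : ∀ x ∈ ltPairs n, 0 < Real.sinc (lam.gap x / 2 * |θ|) := fun x hx =>
    Real.sinc_pos_of_le_one ((hbd x hx).1.trans_le (hbd x hx).2.1) (hbd x hx).2.2
  have hpos2 : ∀ x ∈ ltPairs n, 0 < Real.sinc (rowDist x / 2 * |θ|) := fun x hx =>
    Real.sinc_pos_of_le_one (hbd x hx).1 ((hbd x hx).2.1.trans (hbd x hx).2.2)
  let r : ℝ := ∑ x ∈ ltPairs n, (Real.log (Real.sinc (lam.gap x / 2 * |θ|)) -
    Real.log (Real.sinc (rowDist x / 2 * |θ|)))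
  refine ⟨r, ?_, ?_⟩
  · have h := charFun_standardize_rank hlam t
    simp only [← hV, ← hθ, hsinc] at h
    have hne : ((∏ x ∈ ltPairs n, Real.sinc (rowDist x / 2 * |θ|) : ℝ) : ℂ) ≠ 0 := by
      exact_mod_cast (Finset.prod_pos hpos2).ne'
    apply mul_right_cancel₀ hne
    rw [h, ← Complex.ofReal_mul]
    congr 1
    rw [Real.exp_sum, ← Finset.prod_mul_distrib]
    refine Finset.prod_congr rfl fun x hx => ?_
    rw [Real.exp_sub, Real.exp_log (hpos1 x hx), Real.exp_log (hpos2 x hx),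
      div_mul_cancel₀ _ (hpos2 x hx).ne']
  -- Standardization makes the quadratic terms sum to exactly `t ^ 2 / 2`; only the fourth-order
  -- error remains.
  · have h2 : t ^ 2 / 2 = ∑ x ∈ ltPairs n,
        ((lam.gap x / 2 * |θ|) ^ 2 - (rowDist x / 2 * |θ|) ^ 2) / 6 := by
      have e : ∀ x ∈ ltPairs n, ((lam.gap x / 2 * |θ|) ^ 2 - (rowDist x / 2 * |θ|) ^ 2) / 6 =
          t ^ 2 / (2 * V) * (lam.gap x ^ 2 - rowDist x ^ 2) := by
        intro x _
        rw [mul_pow, mul_pow, sq_abs, hsq]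
        field_simp
        ring
      rw [Finset.sum_congr rfl e, ← Finset.mul_sum, ← gapPowSum, ← hV]
      field_simp
    have h4 : ∑ x ∈ ltPairs n, ((lam.gap x / 2 * |θ|) ^ 4 - (rowDist x / 2 * |θ|) ^ 4) / 90 =
        t ^ 4 / (10 * V ^ 2) * gapPowSum lam n 4 := by
      rw [gapPowSum, Finset.mul_sum]
      refine Finset.sum_congr rfl fun x _ => ?_
      have e : |θ| ^ 4 = (12 * t ^ 2 / V) ^ 2 := by
        rw [← hsq, ← sq_abs θ]
        ring
      rw [mul_pow, mul_pow, e]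
      field_simp
      ring
    rw [h2, ← Finset.sum_add_distrib]
    refine (Finset.abs_sum_le_sum_abs _ _).trans ?_
    refine (Finset.sum_le_sum fun x hx =>
      Real.log_sinc_sub_bounds (hbd x hx).1 (hbd x hx).2.1 (hbd x hx).2.2).trans ?_
    rw [h4]
    calc t ^ 4 / (10 * V ^ 2) * gapPowSum lam n 4
        ≤ t ^ 4 / (10 * V ^ 2) * (2 * D ^ 2 * V) := by
          gcongr
          exact gapPowSum_four_le hD
      _ = t ^ 4 * (D ^ 2 / V) / 5 := by
          field_simp
          ring
      _ ≤ t ^ 4 * (D ^ 2 / V) := by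
          have : 0 ≤ t ^ 4 * (D ^ 2 / V) := by positivity
          linarith

end SemistandardYoungTableau

namespace IsExponentialNotation

open SemistandardYoungTableau

lemma div_gapPowSum_le {lam : YoungDiagram} {m k : ℕ} {ℓ e : ℕ → ℕ}
    (h : IsExponentialNotation lam m k ℓ e) (hw : 0 < weft m k ℓ e) :
    0 < gapPowSum lam m 2 ∧
      ((ℓ 1 : ℝ) - ℓ k - 1 + m) ^ 2 / gapPowSum lam m 2 ≤ 4 / weft m k ℓ e := by
  have h1 := (h.gapPowSum_bounds 1).1
  have hD : 0 < ((ℓ 1 : ℝ) - ℓ k - 1 + m) ^ 2 := by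
    -- If the denominator vanished, `weft` would be `0` by the convention for division by zero.
    refine lt_of_le_of_ne (sq_nonneg _) fun h0 => ?_
    rw [weft, ← h0, div_zero] at hw
    exact lt_irrefl _ hw
  have hP : pairSum k ℓ e 1 = weft m k ℓ e * ((ℓ 1 : ℝ) - ℓ k - 1 + m) ^ 2 := by
    rw [weft, div_mul_cancel₀ _ hD.ne']
  have hpos := mul_pos hw hD
  rw [hP] at h1
  norm_num at h1
  have hV : 0 < gapPowSum lam m 2 := by linarith
  refine ⟨hV, ?_⟩
  rw [div_le_div_iff₀ hV hw]
  linarith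

end IsExponentialNotation

/-! ### The cumulant bounds and the limit theorem -/

open SemistandardYoungTableau in
lemma rankCumulant_bounds {d : ℕ} (hd : 2 ≤ d) (he : Even d) :
    ∃ A B : ℝ, 0 < A ∧ 0 < B ∧
      ∀ (lam : YoungDiagram) (m k : ℕ) (ℓ e : ℕ → ℕ), IsExponentialNotation lam m k ℓ e →
        A * pairSum k ℓ e (d - 1) ≤ (-1 : ℝ) ^ (d / 2 + 1) * rankCumulant lam m d ∧
        (-1 : ℝ) ^ (d / 2 + 1) * rankCumulant lam m d ≤ B * pairSum k ℓ e (d - 1) := by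
  have hpos := Real.iteratedDeriv_logSinhc_pos hd he
  set K : ℝ := (-1 : ℝ) ^ (d / 2 + 1) * iteratedDeriv d Real.logSinhc 0 / 2 ^ d with hK
  have hK0 : 0 < K := by positivity
  have hdpos : (0 : ℝ) < d := by exact_mod_cast (by omega : 0 < d)
  refine ⟨K * (1 / 2) ^ d, K * d, by positivity, by positivity, fun lam m k ℓ e h => ?_⟩
  have hb := h.gapPowSum_bounds (d - 1)
  have hd1 : d - 1 + 1 = d := by omega
  have hd2 : ((d - 1 : ℕ) : ℝ) + 1 = d := by exact_mod_cast hd1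
  rw [hd1, hd2] at hb
  have hc : (-1 : ℝ) ^ (d / 2 + 1) * rankCumulant lam m d = K * gapPowSum lam m d := by
    rw [rankCumulant_eq h.length_le hd, hK]
    ring
  rw [hc, mul_assoc, mul_assoc]
  exact ⟨mul_le_mul_of_nonneg_left hb.1 hK0.le, mul_le_mul_of_nonneg_left hb.2 hK0.le⟩

open SemistandardYoungTableau in
lemma tendsto_charFun_standardize_rank (lam : ℕ → YoungDiagram) (m k : ℕ → ℕ) (ℓ e : ℕ → ℕ → ℕ)
    (h : ∀ N, IsExponentialNotation (lam N) (m N) (k N) (ℓ N) (e N))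
    (hw : Tendsto (fun N => weft (m N) (k N) (ℓ N) (e N)) atTop atTop) {t : ℝ} (ht : t ≠ 0) :
    Tendsto (fun N => charFun ((ssytUniform (lam N) (m N)).map
      (standardize (ssytRankRV (lam N)) (ssytUniform (lam N) (m N)))) t) atTop
      (nhds (Real.exp (-(t ^ 2 / 2)) : ℂ)) := by
  let q : ℕ → ℝ := fun N =>
    ((ℓ N 1 : ℝ) - ℓ N (k N) - 1 + m N) ^ 2 / gapPowSum (lam N) (m N) 2
  have hq : ∀ᶠ N in atTop, 0 < gapPowSum (lam N) (m N) 2 ∧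
      q N ≤ 4 / weft (m N) (k N) (ℓ N) (e N) := by
    filter_upwards [hw.eventually_gt_atTop 0] with N hN using (h N).div_gapPowSum_le hN
  have hq0 : Tendsto q atTop (nhds 0) := by
    refine tendsto_of_tendsto_of_tendsto_of_le_of_le' tendsto_const_nhds
      (hw.const_div_atTop 4) ?_ ?_
    · filter_upwards [hq] with N hN using div_nonneg (sq_nonneg _) hN.1.le
    · filter_upwards [hq] with N hN using hN.2
  have hsmall : ∀ᶠ N in atTop, q N * t ^ 2 ≤ 1 / 3 := by
    have := hq0.mul_const (t ^ 2)
    rw [zero_mul] at this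
    exact this.eventually_le_const (by norm_num)
  -- The conditions are kept as hypotheses so that one sequence `r` can be chosen for all `N`; `0`
  -- is a filler where they fail.
  have hex : ∀ N, ∃ r : ℝ, 0 < gapPowSum (lam N) (m N) 2 → q N * t ^ 2 ≤ 1 / 3 →
      charFun ((ssytUniform (lam N) (m N)).map
        (standardize (ssytRankRV (lam N)) (ssytUniform (lam N) (m N)))) t = (Real.exp r : ℂ) ∧
      |r + t ^ 2 / 2| ≤ t ^ 4 * q N := by
    intro N
    by_cases hc : 0 < gapPowSum (lam N) (m N) 2 ∧ q N * t ^ 2 ≤ 1 / 3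
    · obtain ⟨r, hr⟩ := charFun_standardize_rank_approx (h N).length_le
        (fun x hx => (h N).gap_le hx) ht hc.1 hc.2
      exact ⟨r, fun _ _ => hr⟩
    · exact ⟨0, fun h1 h2 => absurd ⟨h1, h2⟩ hc⟩
  choose r hr using hex
  have hr0 : Tendsto r atTop (nhds (-(t ^ 2 / 2))) := by
    rw [tendsto_iff_norm_sub_tendsto_zero]
    have h0 := hq0.const_mul (t ^ 4)
    rw [mul_zero] at h0
    refine squeeze_zero' (Eventually.of_forall fun N => norm_nonneg _) ?_ h0
    filter_upwards [hq, hsmall] with N h1 h2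
    rw [sub_neg_eq_add]
    exact (hr N h1.1 h2).2
  have hlim : Tendsto (fun N => (Real.exp (r N) : ℂ)) atTop
      (nhds (Real.exp (-(t ^ 2 / 2)) : ℂ)) :=
    (Complex.continuous_ofReal.tendsto _).comp ((Real.continuous_exp.tendsto _).comp hr0)
  refine hlim.congr' ?_
  filter_upwards [hq, hsmall] with N h1 h2 using (hr N h1.1 h2).1.symm

open SemistandardYoungTableau in
-- Lévy's continuity theorem. The point `t = 0` is separate because the approximation needs nonzero
-- arguments.
lemma asymptoticallyNormal_rank (lam : ℕ → YoungDiagram) (m k : ℕ → ℕ) (ℓ e : ℕ → ℕ → ℕ)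
    (h : ∀ N, IsExponentialNotation (lam N) (m N) (k N) (ℓ N) (e N))
    (hw : Tendsto (fun N => weft (m N) (k N) (ℓ N) (e N)) atTop atTop) :
    AsymptoticallyNormal (fun N => ssytRankRV (lam N)) (fun N => ssytUniform (lam N) (m N)) := by
  have hP := fun N => isProbabilityMeasure_ssytUniform (h N).length_le
  refine ⟨hP, ⟨fun N => (measurable_rank _).aemeasurable, aemeasurable_id, ?_⟩⟩
  refine ProbabilityMeasure.tendsto_iff_tendsto_charFun.2 fun t => ?_
  simp only [ProbabilityMeasure.coe_mk, Measure.map_id, charFun_gaussianReal]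
  rcases eq_or_ne t 0 with rfl | ht
  · have : ∀ N, IsProbabilityMeasure ((ssytUniform (lam N) (m N)).map
        (standardize (ssytRankRV (lam N)) (ssytUniform (lam N) (m N)))) := fun N =>
      Measure.isProbabilityMeasure_map (measurable_rank _).aemeasurable
    simp
  · convert! tendsto_charFun_standardize_rank lam m k ℓ e h hw ht using 2
    push_cast
    congr 1
    simp

theorem mainTheorem12 :
    (∀ d : ℕ, 2 ≤ d → Even d →
      ∃ A B : ℝ, 0 < A ∧ 0 < B ∧
        ∀ (lam : YoungDiagram) (m k : ℕ) (ℓ e : ℕ → ℕ),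
          IsExponentialNotation lam m k ℓ e →
            A * pairSum k ℓ e (d - 1) ≤ (-1 : ℝ) ^ (d / 2 + 1) * rankCumulant lam m d ∧
            (-1 : ℝ) ^ (d / 2 + 1) * rankCumulant lam m d ≤ B * pairSum k ℓ e (d - 1)) ∧
    (∀ (lam : ℕ → YoungDiagram) (m k : ℕ → ℕ) (ℓ e : ℕ → ℕ → ℕ),
      (∀ N, IsExponentialNotation (lam N) (m N) (k N) (ℓ N) (e N)) →
      Filter.Tendsto (fun N => weft (m N) (k N) (ℓ N) (e N)) Filter.atTop Filter.atTop →
      AsymptoticallyNormal (fun N => ssytRankRV (lam N))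
        (fun N => ssytUniform (lam N) (m N))) :=
  ⟨fun _ hd he => rankCumulant_bounds hd he, asymptoticallyNormal_rank⟩
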